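/- For a real number $\alpha$, an $\alpha$-decomposition of a finite group $G$ is a pair $(P_1,P_2)$ of subgroups of $G$ such that $G=P_1P_2$, every prime dividing $|P_1|$ is greater than $\alpha$, and every prime dividing $|P_2|$ is at most $\alpha$. An $\alpha$-decomposition $(P_1,P_2)$ of $G$ and an $\alpha$-decomposition $(Q_1,Q_2)$ of $H$ are isomorphic if there is an isomorphism $\varphi:G\to H$ with $\varphi[P_1]=Q_1$ and $\varphi[P_2]=Q_2$. Finite groups are given by their Cayley tables, and subgroups by their characteristic vectors. For every real $\alpha$, isomorphism of finite solvable groups is deterministic polynomial-time Turing reducible to testing isomorphism of $\alpha$-decompositions of the two groups. That is, there are a deterministic oracle machine $M$ and a polynomial $p$ such that for all finite solvable groups $G$ and $H$, given by Cayley tables, and for every oracle that, for all $\alpha$-decompositions $(P_1,P_2)$ of $G$ and $(Q_1,Q_2)$ of $H$, correctly answers whether they are isomorphic (its answers to all other queries being arbitrary), $M$ halts on input $(G,H)$ within $p(|G|+|H|)$ steps and accepts if and only if $G\cong H$. Moreover, the reduction is uniform in $\alpha$, so that $\alpha$ may depend on the order of the groups: a single machine and a single polynomial work for all real $\alpha$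 if the machine is also given the number $\max(0,\lfloor\alpha\rfloor)$ as input. (The machine is a random access machine with addition and truncated subtraction at unit cost; a query to the oracle costs its length plus one.) -/

import Mathlib

open scoped Pointwise

namespace OracleRAM

/-- An oracle answers yes/no queries, a query being a finite sequence of natural numbers. -/
abbrev Oracle := List ℕ → Bool

/-- Programs of a deterministic random access machine with an oracle. There are registers
`0, 1, 2, …` (a program mentions finitely many of them) and a memory addressed by natural numbers.
The only arithmetic is addition and truncated subtraction, so that the unit-cost running time below
agrees with Turing machine time up to a polynomial. -/
inductive Cmd : Type
  /-- do nothing -/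
  | skip : Cmd
  /-- `reg r := k` -/
  | const (r k : ℕ) : Cmd
  /-- `reg r := reg a + reg b` -/
  | add (r a b : ℕ) : Cmd
  /-- `reg r := reg a - reg b` (zero if `reg a < reg b`) -/
  | sub (r a b : ℕ) : Cmd
  /-- `reg r := mem (reg a)` -/
  | load (r a : ℕ) : Cmd
  /-- `mem (reg a) := reg r` -/
  | store (a r : ℕ) : Cmd
  /-- ask the oracle about the word `mem (reg a), …, mem (reg a + reg l - 1)`;
  `reg r := 1` if the answer is yes and `reg r := 0` otherwise -/
  | query (r a l : ℕ) : Cmd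
  /-- `c` and then `d` -/
  | seq (c d : Cmd) : Cmd
  /-- `c` if `reg r ≠ 0`, and `d` otherwise -/
  | ifNZ (r : ℕ) (c d : Cmd) : Cmd
  /-- repeat `c` as long as `reg r ≠ 0` -/
  | whileNZ (r : ℕ) (c : Cmd) : Cmd

/-- Contents of the registers and of the memory. -/
@[ext]
structure State where
  reg : ℕ → ℕ
  mem : ℕ → ℕ

/-- Overwrite one register. -/
def State.setReg (s : State) (r v : ℕ) : State := ⟨Function.update s.reg r v, s.mem⟩

/-- Overwrite one memory cell. -/
def State.setMem (s : State) (a v : ℕ) : State := ⟨s.reg, Function.update s.mem a v⟩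

/-- The word of length `l` stored in memory from address `a` on. -/
def State.word (s : State) (a l : ℕ) : List ℕ := (List.range l).map fun i => s.mem (a + i)

/-- `Exec O c s t s'`: with oracle `O`, the program `c` started in state `s` halts after exactly `t`
steps in state `s'`. Every instruction and every test of a register takes one step, and a query
takes one further step for each number in the queried word. -/
inductive Exec (O : Oracle) : Cmd → State → ℕ → State → Prop
  | skip (s : State) : Exec O .skip s 1 s
  | const (s : State) (r k : ℕ) : Exec O (.const r k) s 1 (s.setReg r k)
  | add (s : State) (r a b : ℕ) : Exec O (.add r a b) s 1 (s.setReg r (s.reg a + s.reg b))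
  | sub (s : State) (r a b : ℕ) : Exec O (.sub r a b) s 1 (s.setReg r (s.reg a - s.reg b))
  | load (s : State) (r a : ℕ) : Exec O (.load r a) s 1 (s.setReg r (s.mem (s.reg a)))
  | store (s : State) (a r : ℕ) : Exec O (.store a r) s 1 (s.setMem (s.reg a) (s.reg r))
  | query (s : State) (r a l : ℕ) :
      Exec O (.query r a l) s (s.reg l + 1)
        (s.setReg r (if O (s.word (s.reg a) (s.reg l)) = true then 1 else 0))
  | seq {c d : Cmd} {s s' s'' : State} {t t' : ℕ} (h : Exec O c s t s') (h' : Exec O d s' t' s'') :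
      Exec O (.seq c d) s (t + t') s''
  | ifTrue {r : ℕ} {c d : Cmd} {s s' : State} {t : ℕ} (hr : s.reg r ≠ 0) (h : Exec O c s t s') :
      Exec O (.ifNZ r c d) s (t + 1) s'
  | ifFalse {r : ℕ} {c d : Cmd} {s s' : State} {t : ℕ} (hr : s.reg r = 0) (h : Exec O d s t s') :
      Exec O (.ifNZ r c d) s (t + 1) s'
  | whileDone {r : ℕ} {c : Cmd} {s : State} (hr : s.reg r = 0) : Exec O (.whileNZ r c) s 1 s
  | whileStep {r : ℕ} {c : Cmd} {s s' s'' : State} {t t' : ℕ} (hr : s.reg r ≠ 0)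
      (h : Exec O c s t s') (h' : Exec O (.whileNZ r c) s' t' s'') :
      Exec O (.whileNZ r c) s (t + t' + 1) s''

/-- Initial state on the input word `w` and the numerical parameter `k`: the word is in memory from
address `0` on, its length is in register `0`, and `k` is in register `1`; all else is zero. -/
def State.initial (w : List ℕ) (k : ℕ) : State where
  reg := fun r => if r = 0 then w.length else if r = 1 then k else 0
  mem := fun i => w.getD i 0

/-- A final state is accepting if register `0` contains `1`. -/
def State.Accepting (s : State) : Prop := s.reg 0 = 1

end OracleRAM

section Encodings

variable {G H : Type} [Group G] [Group H] {m n : ℕ}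

/-- The Cayley table of `G`, row by row, the elements of `G` being numbered by `e`. -/
def cayleyTable (e : G ≃ Fin n) : List ℕ :=
  (List.finRange n).flatMap fun i =>
    (List.finRange n).map fun j => (e (e.symm i * e.symm j) : ℕ)

open Classical in
/-- The list of zeros and ones that describes a subgroup. -/
noncomputable def subgroupCode (e : G ≃ Fin n) (P : Subgroup G) : List ℕ :=
  (List.finRange n).map fun i => if e.symm i ∈ P then 1 else 0

/-- Instances of group isomorphism: the orders and the Cayley tables of the two groups. -/
def groupPairCode (eG : G ≃ Fin m) (eH : H ≃ Fin n) : List ℕ :=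
  m :: n :: (cayleyTable eG ++ cayleyTable eH)

/-- Instances of isomorphism of `α`-decompositions: two groups and a pair of subgroups of each. -/
noncomputable def decompositionPairCode (eG : G ≃ Fin m) (eH : H ≃ Fin n)
    (P₁ P₂ : Subgroup G) (Q₁ Q₂ : Subgroup H) : List ℕ :=
  groupPairCode eG eH ++ subgroupCode eG P₁ ++ subgroupCode eG P₂ ++
    subgroupCode eH Q₁ ++ subgroupCode eH Q₂

end Encodings

/-- `(P₁, P₂)` is an `α`-decomposition of `G`. -/
structure IsAlphaDecomposition {G : Type} [Group G] (α : ℝ) (P₁ P₂ : Subgroup G) : Prop where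
  mul_eq : (P₁ : Set G) * (P₂ : Set G) = Set.univ
  lt_of_dvd : ∀ p : ℕ, p.Prime → p ∣ Nat.card P₁ → α < p
  le_of_dvd : ∀ p : ℕ, p.Prime → p ∣ Nat.card P₂ → (p : ℝ) ≤ α

/-- The pairs of subgroups `(P₁, P₂)` and `(Q₁, Q₂)` are isomorphic: some isomorphism from `G` to
`H` maps `P₁` onto `Q₁` and `P₂` onto `Q₂`. -/
def PairIso {G H : Type} [Group G] [Group H] (P₁ P₂ : Subgroup G) (Q₁ Q₂ : Subgroup H) : Prop :=
  ∃ φ : G ≃* H, P₁.map φ.toMonoidHom = Q₁ ∧ P₂.map φ.toMonoidHom = Q₂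

/-- `O` tests isomorphism of `α`-decompositions of the groups `G` and `H`. Its answers to all other
queries (including pairs that are not `α`-decompositions, and all other groups) are arbitrary. -/
def TestsAlphaDecompositionIso {G H : Type} [Group G] [Group H] {m n : ℕ} (α : ℝ)
    (eG : G ≃ Fin m) (eH : H ≃ Fin n) (O : OracleRAM.Oracle) : Prop :=
  ∀ (P₁ P₂ : Subgroup G) (Q₁ Q₂ : Subgroup H),
    IsAlphaDecomposition α P₁ P₂ → IsAlphaDecomposition α Q₁ Q₂ →
      (O (decompositionPairCode eG eH P₁ P₂ Q₁ Q₂) = true ↔ PairIso P₁ P₂ Q₁ Q₂)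

/-- With oracle `O`, on the Cayley tables of `G` and `H` and the numerical parameter `k`, the
program `M` decides within `p (|G| + |H|)` steps whether `G` and `H` are isomorphic. -/
def DecidesGroupIso {G H : Type} [Group G] [Group H] {m n : ℕ} (M : OracleRAM.Cmd)
    (p : Polynomial ℕ) (O : OracleRAM.Oracle) (k : ℕ) (eG : G ≃ Fin m) (eH : H ≃ Fin n) : Prop :=
  ∃ (t : ℕ) (s : OracleRAM.State),
    OracleRAM.Exec O M (OracleRAM.State.initial (groupPairCode eG eH) k) t s ∧
      t ≤ p.eval (m + n) ∧ (s.Accepting ↔ Nonempty (G ≃* H))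

/-!
# Reducing isomorphism of solvable groups to isomorphism of `α`-decompositions

Let `π` be the set of primes greater than `k = ⌊α⌋₊`. In a finite solvable group, Hall's theorems hold
(`exists_isHall`, `IsHall.exists_le_conj`): there are Hall `π`-subgroups, and every `π`-subgroup lies
in a conjugate of any of them. Two consequences make the reduction work.

* Every maximal `π`-subgroup is a Hall subgroup (`isHall_of_maximal`), so that one can be computed
  greedily: run through the elements `x` of the group, and replace the current subgroup `P` by
  `⟨P, x⟩` whenever the latter is still a `π`-group. A Hall `π'`-subgroup is obtained in the same
  way, as a maximal subgroup of order coprime to that of the Hall `π`-subgroup. Such a pair is an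
  `α`-decomposition.
* Any isomorphism of the groups can be corrected by one inner automorphism to match the two chosen
  pairs (`pairIso_iff_nonempty_mulEquiv`), so that the two decompositions are isomorphic exactly if
  the groups are. Hence one query decides isomorphism.

Existence and domination are each proved by induction on the order, passing to the quotient by an
abelian normal subgroup `A` whose order is a `π`-number or a `π'`-number. The second case is settled by the existence and the conjugacy of complements of `A`; Mathlib has the
existence part of the Schur–Zassenhaus theorem, and the conjugacy part for abelian `A` comes from the
same action on transversals (`Subgroup.IsComplement'.exists_conj_of_coprime`).

The machine program is verified with a small calculus of total correctness: `OracleRAM.WP O c T Q s`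
says that `c`, started in `s`, halts within `T` steps in a state satisfying `Q`, and
`OracleRAM.WP.forLoop` is the rule for counting loops. All loops of the program run over the
elements of a group or over numbers bounded by its order, which gives a polynomial bound.
Throughout, register `2` contains the constant `1`, and the group being treated is described by its
order in register `3` and the address of its Cayley table in register `4`; register `5` has the
address of the output, register `6` that of a scratch space, and the registers `7` and `8` contain
the parameters `K` and `M` of the condition `AvoidsDivisors` on the orders of subgroups.
-/

/-! ### Hall subgroups of finite solvable groups -/

/-- Every prime divisor of `n` satisfies `π`. -/
def PrimesIn (π : ℕ → Prop) (n : ℕ) : Prop := ∀ p : ℕ, p.Prime → p ∣ n → π p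

namespace PrimesIn

variable {π : ℕ → Prop} {a b : ℕ}

theorem of_dvd (h : PrimesIn π b) (hab : a ∣ b) : PrimesIn π a :=
  fun p hp hpa => h p hp (hpa.trans hab)

theorem mul (ha : PrimesIn π a) (hb : PrimesIn π b) : PrimesIn π (a * b) :=
  fun p hp h => (hp.dvd_mul.1 h).elim (ha p hp) (hb p hp)

theorem one : PrimesIn π 1 := fun _ hp h => (hp.one_lt.ne' (Nat.dvd_one.1 h)).elim

theorem coprime (ha : PrimesIn π a) (hb : PrimesIn (fun p => ¬ π p) b) : a.Coprime b :=
  Nat.coprime_of_dvd fun p hp h h' => hb p hp h' (ha p hp h)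

end PrimesIn

/-- `K` is a Hall `π`-subgroup: its order is a `π`-number and its index is a `π'`-number. -/
structure IsHall {G : Type*} [Group G] (π : ℕ → Prop) (K : Subgroup G) : Prop where
  card : PrimesIn π (Nat.card K)
  index : PrimesIn (fun p => ¬ π p) K.index

/-- Conjugacy part of the Schur–Zassenhaus theorem, for an abelian normal subgroup. Right
translation makes the group act on the set of transversals of `A` modulo `diff`, transitively
already under `A`; a complement of `A` is the stabilizer of its own class. -/
theorem Subgroup.IsComplement'.exists_conj_of_coprime {G : Type*} [Group G] [Finite G]
    {A H K : Subgroup G} [A.Normal] [IsMulCommutative A]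
    (hA : (Nat.card A).Coprime A.index) (hH : H.IsComplement' A) (hK : K.IsComplement' A) :
    ∃ g : G, H = K.map (MulAut.conj g).toMonoidHom := by
  have key : ∀ L : Subgroup G, L.IsComplement' A → ∃ α : A.QuotientDiff,
      L = MulAction.stabilizer G α := by
    intro L hL
    refine ⟨Quotient.mk'' ⟨(L : Set G), hL⟩, ?_⟩
    refine Subgroup.eq_of_le_of_card_ge (fun l hl => ?_) ?_
    · refine congrArg Quotient.mk'' (Subtype.ext ?_)
      change MulOpposite.op l⁻¹ • (L : Set G) = L
      ext x
      rw [Set.mem_smul_set_iff_inv_smul_mem]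
      simp [Subgroup.mul_mem_cancel_right _ hl]
    · have h1 := hL.card_mul_card
      have h2 := (Subgroup.isComplement'_stabilizer_of_coprime
        (α := Quotient.mk'' ⟨(L : Set G), hL⟩) hA).card_mul_card
      rw [mul_comm] at h1
      exact (Nat.eq_of_mul_eq_mul_left Nat.card_pos (h2.trans h1.symm)).le
  obtain ⟨α, rfl⟩ := key H hH
  obtain ⟨β, rfl⟩ := key K hK
  obtain ⟨a, rfl⟩ := Subgroup.exists_smul_eq hA β α
  exact ⟨a, MulAction.stabilizer_smul_eq_stabilizer_map_conj (a : G) β⟩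

/-- A nontrivial finite solvable group has a nontrivial abelian normal subgroup of exponent `p`, in
the last nontrivial term of its derived series; for each `π` its order is a `π`-number or a
`π'`-number. -/
theorem exists_normal_commutative_primesIn (G : Type*) [Group G] [Finite G] [Group.IsSolvable G]
    [Nontrivial G] (π : ℕ → Prop) :
    ∃ A : Subgroup G, A.Normal ∧ IsMulCommutative A ∧ A ≠ ⊥ ∧
      (PrimesIn π (Nat.card A) ∨ PrimesIn (fun p => ¬ π p) (Nat.card A)) := by
  classical
  have hex : ∃ n, derivedSeries G n = ⊥ := Group.IsSolvable.solvable
  obtain ⟨k, hk⟩ : ∃ k, Nat.find hex = k + 1 := by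
    refine Nat.exists_eq_succ_of_ne_zero fun h0 => ?_
    have := Nat.find_spec hex
    rw [h0, derivedSeries_zero] at this
    exact top_ne_bot this
  set D := derivedSeries G k with hD
  have hDbot : D ≠ ⊥ := Nat.find_min hex (by omega)
  have hDcomm : ∀ x ∈ D, ∀ y ∈ D, x * y = y * x := by
    have h := Nat.find_spec hex
    rw [hk, derivedSeries_succ] at h
    intro x hx y hy
    have := Subgroup.commutator_mem_commutator hx hy
    rw [h, Subgroup.mem_bot] at this
    exact commutatorElement_eq_one_iff_mul_comm.1 this
  have hDn : D.Normal := derivedSeries_normal G k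
  obtain ⟨p, hp, hpD⟩ : ∃ p, p.Prime ∧ p ∣ Nat.card D :=
    Nat.exists_prime_and_dvd fun h => hDbot (Subgroup.card_eq_one.1 h)
  have := Fact.mk hp
  let A : Subgroup G :=
    { carrier := {x | x ∈ D ∧ x ^ p = 1}
      one_mem' := ⟨D.one_mem, one_pow p⟩
      mul_mem' := fun {x y} hx hy => ⟨D.mul_mem hx.1 hy.1, by
        rw [(show Commute x y from hDcomm x hx.1 y hy.1).mul_pow, hx.2, hy.2, one_mul]⟩
      inv_mem' := fun {x} hx => ⟨D.inv_mem hx.1, by rw [inv_pow, hx.2, inv_one]⟩ }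
  have hAp : PrimesIn (fun q => q = p) (Nat.card A) := by
    intro q hq hqA
    have := Fact.mk hq
    obtain ⟨x, hx⟩ := exists_prime_orderOf_dvd_card' q hqA
    have h1 : orderOf x ∣ p := orderOf_dvd_of_pow_eq_one (Subtype.ext x.2.2)
    rw [hx] at h1
    exact (Nat.prime_dvd_prime_iff_eq hq hp).1 h1
  refine ⟨A, ⟨fun x hx g => ⟨hDn.conj_mem x hx.1 g, by
    rw [conj_pow, hx.2, mul_one, mul_inv_cancel]⟩⟩,
    ⟨⟨fun x y => Subtype.ext (hDcomm x x.2.1 y y.2.1)⟩⟩, fun h => ?_, ?_⟩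
  · obtain ⟨x, hx⟩ := exists_prime_orderOf_dvd_card' p hpD
    have hxA : (x : G) ∈ A := ⟨x.2, by
      rw [← hx]
      exact_mod_cast congrArg Subtype.val (pow_orderOf_eq_one x)⟩
    rw [h, Subgroup.mem_bot] at hxA
    have hx1 : x = 1 := Subtype.ext hxA
    rw [hx1, orderOf_one] at hx
    exact hp.one_lt.ne hx
  · by_cases h : π p
    · exact .inl fun q hq hqA => by rw [hAp q hq hqA]; exact h
    · exact .inr fun q hq hqA => by rw [hAp q hq hqA]; exact h

section Hall

variable {G : Type*} [Group G] {π : ℕ → Prop}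

theorem card_sup_dvd_mul_of_normal (P A : Subgroup G) [A.Normal] :
    Nat.card (P ⊔ A : Subgroup G) ∣ Nat.card P * Nat.card A := by
  have h : Nat.card A * A.relIndex (P ⊔ A) = Nat.card (P ⊔ A : Subgroup G) := by
    simp only [← Subgroup.relIndex_bot_left]
    exact Subgroup.relIndex_mul_relIndex _ _ _ bot_le le_sup_right
  rw [← h, Subgroup.relIndex_sup_right, mul_comm]
  refine mul_dvd_mul_right ?_ _
  rw [Subgroup.relIndex]
  exact Subgroup.index_dvd_card _

/-- A Hall `π`-subgroup is a maximal `π`-subgroup. -/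
theorem IsHall.eq_of_le [Finite G] {K X : Subgroup G}
    (hK : IsHall π K) (hX : PrimesIn π (Nat.card X))
    (h : K ≤ X) : K = X := by
  have h1 : K.relIndex X ∣ K.index := ⟨X.index, (Subgroup.relIndex_mul_index h).symm⟩
  have h2 : K.relIndex X ∣ Nat.card X := Subgroup.index_dvd_card _
  have h3 : K.relIndex X = 1 := Nat.eq_one_of_dvd_coprimes
    ((hX.coprime hK.index)) h2 h1
  exact le_antisymm h (Subgroup.relIndex_eq_one.1 h3)

theorem IsHall.map_equiv {G' : Type*} [Group G'] {K : Subgroup G} (hK : IsHall π K) (φ : G ≃* G') :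
    IsHall π (K.map φ.toMonoidHom) := by
  refine ⟨?_, ?_⟩
  · rw [Subgroup.card_map_of_injective φ.injective]; exact hK.card
  · rw [show (K.map φ.toMonoidHom).index = K.index from Subgroup.index_map_equiv K φ]
    exact hK.index

/-- Orders of quotients by nontrivial subgroups drop. -/
theorem card_quotient_lt [Finite G] {A : Subgroup G} (hA : A ≠ ⊥) :
    Nat.card (G ⧸ A) < Nat.card G := by
  rw [← Subgroup.card_mul_index A, ← Subgroup.index_eq_card]
  have h1 : 1 < Nat.card A := (Subgroup.one_lt_card_iff_ne_bot A).2 hA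
  have h2 : 0 < A.index := Nat.pos_of_ne_zero Subgroup.FiniteIndex.index_ne_zero
  nlinarith

/-- Hall's existence theorem: a Hall subgroup of `G ⧸ A`, with `A` as in
`exists_normal_commutative_primesIn`, lifts to a Hall subgroup of `G`, directly or after splitting
off `A` by the Schur–Zassenhaus theorem. -/
theorem exists_isHall (G : Type*) [Group G] [Finite G] [Group.IsSolvable G] (π : ℕ → Prop) :
    ∃ K : Subgroup G, IsHall π K := by
  induction hn : Nat.card G using Nat.strong_induction_on generalizing G with
  | _ n ih =>
  subst hn
  rcases subsingleton_or_nontrivial G with hG | hG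
  · exact ⟨⊤, by rw [Subsingleton.elim (⊤ : Subgroup G) ⊥, Subgroup.card_bot]; exact .one,
      by rw [Subgroup.index_top]; exact .one⟩
  obtain ⟨A, hAn, -, hA, hAπ⟩ := exists_normal_commutative_primesIn G π
  obtain ⟨L', hL'⟩ := ih _ (card_quotient_lt hA) (G ⧸ A) rfl
  set L := L'.comap (QuotientGroup.mk' A) with hLdef
  have hAL : A ≤ L := fun a ha => by
    rw [hLdef, Subgroup.mem_comap, QuotientGroup.mk'_apply, (QuotientGroup.eq_one_iff a).2 ha]
    exact L'.one_mem
  have hLi : L.index = L'.index :=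
    Subgroup.index_comap_of_surjective _ (QuotientGroup.mk'_surjective A)
  have hrel : A.relIndex L = Nat.card L' := by
    have h1 : A.relIndex L * L.index = A.index := Subgroup.relIndex_mul_index hAL
    have h2 := L'.card_mul_index
    rw [← hLi, ← Subgroup.index_eq_card, ← h1] at h2
    exact (Nat.eq_of_mul_eq_mul_right
      (Nat.pos_of_ne_zero Subgroup.FiniteIndex.index_ne_zero) h2).symm
  have hLc : Nat.card A * Nat.card L' = Nat.card L := by
    rw [← hrel]
    simp only [← Subgroup.relIndex_bot_left]
    exact Subgroup.relIndex_mul_relIndex _ _ _ bot_le hAL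
  rcases hAπ with hAπ | hAπ
  · exact ⟨L, hLc ▸ hAπ.mul hL'.card, hLi ▸ hL'.index⟩
  · have hcA : Nat.card (A.subgroupOf L) = Nat.card A :=
      Nat.card_congr (Subgroup.subgroupOfEquivOfLe hAL).toEquiv
    obtain ⟨K, hK⟩ := Subgroup.exists_left_complement'_of_coprime (N := A.subgroupOf L)
      (by
          rw [hcA, show (A.subgroupOf L).index = Nat.card L' from hrel]
          exact (hL'.card.coprime hAπ).symm)
    refine ⟨K.map L.subtype, ?_, ?_⟩
    · rw [Subgroup.card_map_of_injective L.subtype_injective, ← hK.index_eq_card]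
      rw [show (A.subgroupOf L).index = Nat.card L' from hrel]
      exact hL'.card
    · rw [Subgroup.index_map_subtype, hK.symm.index_eq_card, hcA, hLi]
      exact hAπ.mul hL'.index

/-- In a finite solvable group every `π`-subgroup lies in a conjugate of a given Hall
`π`-subgroup. -/
theorem IsHall.exists_le_conj {G : Type*} [Group G] [Finite G] [Group.IsSolvable G]
    {K P : Subgroup G} (hK : IsHall π K) (hP : PrimesIn π (Nat.card P)) :
    ∃ g : G, P ≤ K.map (MulAut.conj g).toMonoidHom := by
  induction hn : Nat.card G using Nat.strong_induction_on generalizing G with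
  | _ n ih =>
  subst hn
  rcases subsingleton_or_nontrivial G with hG | hG
  · exact ⟨1, le_of_eq (Subsingleton.elim _ _)⟩
  obtain ⟨A, hAn, hAc, hA, hAπ⟩ := exists_normal_commutative_primesIn G π
  have hsurj := QuotientGroup.mk'_surjective A
  obtain ⟨q, hq⟩ := ih _ (card_quotient_lt hA) (G := G ⧸ A)
    (K := K.map (QuotientGroup.mk' A)) (P := P.map (QuotientGroup.mk' A))
    ⟨hK.card.of_dvd (Subgroup.card_map_dvd _ _), hK.index.of_dvd (Subgroup.index_map_dvd _ hsurj)⟩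
    (hP.of_dvd (Subgroup.card_map_dvd _ _)) rfl
  obtain ⟨g, rfl⟩ := hsurj q
  set K₁ := K.map (MulAut.conj g).toMonoidHom with hK₁def
  have hK₁ : IsHall π K₁ := hK.map_equiv _
  have hPK : P ≤ K₁ ⊔ A := by
    have h1 : (K.map (QuotientGroup.mk' A)).map
        (MulAut.conj (QuotientGroup.mk' A g)).toMonoidHom = K₁.map (QuotientGroup.mk' A) := by
      rw [hK₁def, Subgroup.map_map, Subgroup.map_map]
      congr 1
    rw [h1, Subgroup.map_le_iff_le_comap, Subgroup.comap_map_eq, QuotientGroup.ker_mk'] at hq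
    exact hq
  suffices h : ∃ x : G, P ≤ K₁.map (MulAut.conj x).toMonoidHom by
    obtain ⟨x, hx⟩ := h
    refine ⟨x * g, hx.trans (le_of_eq ?_)⟩
    rw [hK₁def, Subgroup.map_map]
    congr 1
    ext y
    simp
  rcases hAπ with hAπ | hAπ
  · have : K₁ = K₁ ⊔ A := hK₁.eq_of_le
      ((hK₁.card.mul hAπ).of_dvd (card_sup_dvd_mul_of_normal K₁ A)) le_sup_left
    refine ⟨1, ?_⟩
    rw [← this] at hPK
    rw [map_one]
    exact hPK.trans (Subgroup.map_id K₁).ge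
  · -- Inside `P ⊔ A`, both `P` and the trace of `K₁` are complements of `A`.
    set X := P ⊔ A with hX
    have hAX : A ≤ X := le_sup_right
    have hPX : P ≤ X := le_sup_left
    have hcA : Nat.card (A.subgroupOf X) = Nat.card A :=
      Nat.card_congr (Subgroup.subgroupOfEquivOfLe hAX).toEquiv
    have hcP : Nat.card (P.subgroupOf X) = Nat.card P :=
      Nat.card_congr (Subgroup.subgroupOfEquivOfLe hPX).toEquiv
    have hcK : PrimesIn π (Nat.card (K₁.subgroupOf X)) := by
      refine hK₁.card.of_dvd ?_
      rw [← Subgroup.card_map_of_injective X.subtype_injective]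
      refine Subgroup.card_dvd_of_le ?_
      rw [Subgroup.subgroupOf_map_subtype]
      exact inf_le_left
    have hcompl : ∀ L : Subgroup G, PrimesIn π (Nat.card (L.subgroupOf X)) → X ≤ L ⊔ A →
        (L.subgroupOf X).IsComplement' (A.subgroupOf X) := by
      intro L hL hle
      refine Subgroup.isComplement'_of_disjoint_and_mul_eq_univ
        (Subgroup.disjoint_of_coprime_natCard (hL.coprime (hcA.symm ▸ hAπ)))
        (Set.eq_univ_of_forall fun x => ?_)
      obtain ⟨y, hy, a, ha, hya⟩ := Subgroup.mem_sup_of_normal_right.1 (hle x.2)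
      have hyX : y ∈ X := by
        rw [← mul_inv_eq_of_eq_mul hya.symm]
        exact X.mul_mem x.2 (X.inv_mem (hAX ha))
      exact Set.mem_mul.2 ⟨⟨y, hyX⟩, hy, ⟨a, hAX ha⟩, ha, Subtype.ext hya⟩
    have hPc := hcompl P (hcP.symm ▸ hP) le_rfl
    have hKc := hcompl K₁ hcK (sup_le hPK le_sup_right)
    have : IsMulCommutative (A.subgroupOf X) :=
      ⟨⟨fun a b => Subtype.ext (Subtype.ext (congrArg (Subtype.val : A → G)
        (hAc.is_comm.comm ⟨a.1.1, a.2⟩ ⟨b.1.1, b.2⟩)))⟩⟩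
    obtain ⟨x, hx⟩ := Subgroup.IsComplement'.exists_conj_of_coprime
      (by rw [hPc.index_eq_card, hcA, hcP]; exact (hP.coprime hAπ).symm) hPc hKc
    refine ⟨x, fun y hy => ?_⟩
    have hyx : (⟨y, hPX hy⟩ : X) ∈ P.subgroupOf X := hy
    rw [hx] at hyx
    obtain ⟨z, hz, hzy⟩ := hyx
    exact ⟨z, hz, congrArg Subtype.val hzy⟩

/-- In a finite solvable group the maximal `π`-subgroups are the Hall `π`-subgroups. -/
theorem isHall_of_maximal [Finite G] [Group.IsSolvable G] {P : Subgroup G}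
    (hP : PrimesIn π (Nat.card P))
    (hmax : ∀ X : Subgroup G, P ≤ X → PrimesIn π (Nat.card X) → X ≤ P) : IsHall π P := by
  obtain ⟨K, hK⟩ := exists_isHall G π
  obtain ⟨g, hg⟩ := hK.exists_le_conj hP
  have hKg := hK.map_equiv (MulAut.conj g)
  rwa [le_antisymm hg (hmax _ hg hKg.card)]

theorem IsHall.exists_conj_eq [Finite G] [Group.IsSolvable G] {K L : Subgroup G}
    (hK : IsHall π K) (hL : IsHall π L) :
    ∃ g : G, K.map (MulAut.conj g).toMonoidHom = L := by
  obtain ⟨g, hg⟩ := hK.exists_le_conj hL.card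
  exact ⟨g, (hL.eq_of_le (hK.map_equiv (MulAut.conj g)).card hg).symm⟩

theorem IsHall.mul_eq_univ [Finite G] {K L : Subgroup G}
    (hK : IsHall π K) (hL : IsHall (fun p => ¬ π p) L) : (K : Set G) * (L : Set G) = Set.univ := by
  have hc : (Nat.card K).Coprime (Nat.card L) := hK.card.coprime hL.card
  have h1 : K.index ∣ Nat.card L := by
    refine Nat.Coprime.dvd_of_dvd_mul_right (k := K.index) (m := Nat.card L) (n := L.index) ?_ ?_
    · exact hK.index.coprime hL.index
    · rw [L.card_mul_index]; exact K.index_dvd_card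
  have h2 : Nat.card K * Nat.card L = Nat.card G := by
    refine Nat.dvd_antisymm
      (hc.mul_dvd_of_dvd_of_dvd K.card_subgroup_dvd_card L.card_subgroup_dvd_card) ?_
    rw [← K.card_mul_index]
    exact mul_dvd_mul_left _ h1
  exact (Subgroup.isComplement'_of_coprime h2 hc).mul_eq

theorem map_conj_mul_of_mem {P : Subgroup G} {x : G} (hx : x ∈ P) (a : G) :
    P.map (MulAut.conj (a * x)).toMonoidHom = P.map (MulAut.conj a).toMonoidHom := by
  have hPx : P.map (MulAut.conj x).toMonoidHom = P := by
    refine le_antisymm ?_ fun y hy => ⟨x⁻¹ * y * x,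
      P.mul_mem (P.mul_mem (P.inv_mem hx) hy) hx, by simp [mul_assoc]⟩
    rintro _ ⟨y, hy, rfl⟩
    exact P.mul_mem (P.mul_mem hx hy) (P.inv_mem hx)
  conv_rhs => rw [← hPx]
  rw [Subgroup.map_map]
  congr 1
  ext y
  simp

/-- Pairs of complementary Hall subgroups of isomorphic solvable groups are isomorphic: each
subgroup can be conjugated into place, by `a` and by `b` say, and the factorization of `a⁻¹ * b`
along the pair turns these into one simultaneous conjugation. -/
theorem pairIso_iff_nonempty_mulEquiv {G H : Type} [Group G] [Group H] [Finite H]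
    [Group.IsSolvable H] {P₁ P₂ : Subgroup G} {Q₁ Q₂ : Subgroup H}
    (hP₁ : IsHall π P₁) (hP₂ : IsHall (fun p => ¬ π p) P₂)
    (hQ₁ : IsHall π Q₁) (hQ₂ : IsHall (fun p => ¬ π p) Q₂) :
    PairIso P₁ P₂ Q₁ Q₂ ↔ Nonempty (G ≃* H) := by
  refine ⟨fun ⟨φ, _⟩ => ⟨φ⟩, fun ⟨φ⟩ => ?_⟩
  have h₁ := hP₁.map_equiv φ
  have h₂ := hP₂.map_equiv φ
  obtain ⟨a, ha⟩ := h₁.exists_conj_eq hQ₁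
  obtain ⟨b, hb⟩ := h₂.exists_conj_eq hQ₂
  obtain ⟨x, hx, y, hy, hxy⟩ := Set.mem_mul.1
    ((h₁.mul_eq_univ h₂).symm ▸ Set.mem_univ (a⁻¹ * b))
  have hg : a * x = b * y⁻¹ := by
    rw [eq_mul_inv_iff_mul_eq, mul_assoc, hxy, mul_inv_cancel_left]
  have hcomp : ∀ P : Subgroup G, P.map (φ.trans (MulAut.conj (a * x))).toMonoidHom =
      (P.map φ.toMonoidHom).map (MulAut.conj (a * x)).toMonoidHom := fun P => by
    rw [Subgroup.map_map]
    rfl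
  refine ⟨φ.trans (MulAut.conj (a * x)), ?_, ?_⟩
  · rw [hcomp, map_conj_mul_of_mem hx, ha]
  · rw [hcomp, hg, map_conj_mul_of_mem (Subgroup.inv_mem _ hy), hb]

end Hall

theorem IsHall.isAlphaDecomposition {G : Type} [Group G] [Finite G] {α : ℝ} {P₁ P₂ : Subgroup G}
    (h₁ : IsHall (fun p => ⌊α⌋₊ < p) P₁) (h₂ : IsHall (fun p => ¬ ⌊α⌋₊ < p) P₂) :
    IsAlphaDecomposition α P₁ P₂ where
  mul_eq := h₁.mul_eq_univ h₂
  lt_of_dvd p hp h := (Nat.floor_lt' hp.ne_zero).1 (h₁.card p hp h)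
  le_of_dvd p hp h := (Nat.le_floor_iff' hp.ne_zero).1 (not_lt.1 (h₂.card p hp h))

/-! ### A greedy algorithm for Hall subgroups -/

/-- No `d` with `2 ≤ d ≤ K` divides both `M` and `x`. With `M = 0`, a multiple of every `d`, this
says that the prime divisors of `x` exceed `K`. -/
def AvoidsDivisors (K M x : ℕ) : Prop := ∀ d, 2 ≤ d → d ≤ K → d ∣ M → ¬ d ∣ x

theorem avoidsDivisors_iff {K M x : ℕ} :
    AvoidsDivisors K M x ↔ PrimesIn (fun p => ¬ (p ≤ K ∧ p ∣ M)) x := by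
  refine ⟨fun h p hp hx hK => h p hp.two_le hK.1 hK.2 hx, fun h d hd hK hM hx => ?_⟩
  obtain ⟨p, hp, hpd⟩ := Nat.exists_prime_and_dvd (show d ≠ 1 by omega)
  exact h p hp (hpd.trans hx) ⟨(Nat.le_of_dvd (by omega) hpd).trans hK, hpd.trans hM⟩

/-- `P` is maximal among the subgroups whose order satisfies `AvoidsDivisors K M`. -/
structure IsGreedyOutput {G : Type*} [Group G] (K M : ℕ) (P : Subgroup G) : Prop where
  avoids : AvoidsDivisors K M (Nat.card P)
  le : ∀ X : Subgroup G, P ≤ X → AvoidsDivisors K M (Nat.card X) → X ≤ P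

theorem IsGreedyOutput.isHall {G : Type*} [Group G] [Finite G] [Group.IsSolvable G] {K M : ℕ}
    {P : Subgroup G} (h : IsGreedyOutput K M P) :
    IsHall (fun p => ¬ (p ≤ K ∧ p ∣ M)) P :=
  isHall_of_maximal (avoidsDivisors_iff.1 h.avoids) fun X hX hc =>
    h.le X hX (avoidsDivisors_iff.2 hc)

theorem IsHall.congr_dvd {G : Type*} [Group G] {π ρ : ℕ → Prop} {P : Subgroup G} (h : IsHall π P)
    (hπ : ∀ p, p.Prime → p ∣ Nat.card G → (π p ↔ ρ p)) : IsHall ρ P where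
  card p hp hd := (hπ p hp (hd.trans P.card_subgroup_dvd_card)).1 (h.card p hp hd)
  index p hp hd := (not_congr (hπ p hp (hd.trans P.index_dvd_card))).1 (h.index p hp hd)

/-- The output for the bound `k` is a Hall subgroup for the primes greater than `k`. -/
theorem IsGreedyOutput.isHall_lt {G : Type*} [Group G] [Finite G] [Group.IsSolvable G] {k : ℕ}
    {P : Subgroup G} (h : IsGreedyOutput k 0 P) : IsHall (fun p => k < p) P :=
  h.isHall.congr_dvd fun p _ _ => by simp

/-- A subgroup that is maximal among those of order coprime to the order of a Hall `π`-subgroup is a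
Hall `π'`-subgroup. -/
theorem IsGreedyOutput.isHall_compl {G : Type*} [Group G] [Finite G] [Group.IsSolvable G]
    {π : ℕ → Prop} {P₁ P₂ : Subgroup G} (h₁ : IsHall π P₁)
    (h₂ : IsGreedyOutput (Nat.card G) (Nat.card P₁) P₂) : IsHall (fun p => ¬ π p) P₂ := by
  refine h₂.isHall.congr_dvd fun p hp hd => not_congr ⟨fun h => h₁.card p hp h.2, fun h => ?_⟩
  refine ⟨Nat.le_of_dvd Nat.card_pos hd, ?_⟩
  rw [← P₁.card_mul_index, hp.dvd_mul] at hd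
  exact hd.resolve_right fun h' => h₁.index p hp h' h

theorem AvoidsDivisors.of_le {G : Type*} [Group G] {K M : ℕ} {P Q : Subgroup G}
    (h : AvoidsDivisors K M (Nat.card Q)) (hPQ : P ≤ Q) : AvoidsDivisors K M (Nat.card P) :=
  fun d hd hK hM hx => h d hd hK hM (hx.trans (Subgroup.card_dvd_of_le hPQ))

theorem AvoidsDivisors.card_bot {G : Type*} [Group G] {K M : ℕ} :
    AvoidsDivisors K M (Nat.card (⊥ : Subgroup G)) := fun d hd _ _ hx => by
  rw [Subgroup.card_bot, Nat.dvd_one] at hx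
  omega

/-- If a set is closed under multiplication and lies between a nonempty set and the subgroup
generated by it, in a finite group, then it is that subgroup. -/
theorem eq_closure_of_mul_subset {G : Type*} [Group G] [Finite G] {S T : Set G} (hS : S.Nonempty)
    (hST : S ⊆ T) (hT : T ⊆ Subgroup.closure S) (hmul : ∀ a ∈ T, ∀ b ∈ T, a * b ∈ T) :
    T = Subgroup.closure S := by
  refine hT.antisymm ?_
  have hpow : ∀ a ∈ T, ∀ n : ℕ, a ^ (n + 1) ∈ T := by
    intro a ha n
    induction n with
    | zero => simpa using ha
    | succ n ih => rw [pow_succ]; exact hmul _ ih _ ha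
  have hinv : ∀ a ∈ T, a⁻¹ ∈ T := by
    intro a ha
    obtain ⟨n, hn⟩ : ∃ n, 2 * orderOf a = n + 2 := ⟨2 * orderOf a - 2, by
      have := orderOf_pos a; omega⟩
    have : a⁻¹ = a ^ (n + 1) := by
      rw [inv_eq_iff_mul_eq_one, ← pow_succ', ← hn, mul_comm, pow_mul, pow_orderOf_eq_one, one_pow]
    rw [this]
    exact hpow a ha n
  obtain ⟨s, hs⟩ := hS
  let U : Subgroup G :=
    { carrier := T
      one_mem' := mul_inv_cancel s ▸ hmul _ (hST hs) _ (hinv _ (hST hs))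
      mul_mem' := fun ha hb => hmul _ ha _ hb
      inv_mem' := fun ha => hinv _ ha }
  exact (Subgroup.closure_le U).2 hST

/-! ### Total correctness of machine programs -/

namespace OracleRAM

variable {O : Oracle} {c d : Cmd} {s s₀ s₁ s₂ : State} {Q Q' : State → Prop} {T T₁ T₂ b : ℕ}

/-- Sequential composition of programs. -/
infixr:60 " ;; " => Cmd.seq

section

variable (s : State) (r a v r' a' : ℕ)

@[simp] theorem State.reg_setReg : (s.setReg r v).reg r' = if r' = r then v else s.reg r' := by
  simp [State.setReg, Function.update_apply]

@[simp] theorem State.mem_setReg : (s.setReg r v).mem = s.mem := rfl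

@[simp] theorem State.reg_setMem : (s.setMem a v).reg = s.reg := rfl

@[simp] theorem State.mem_setMem : (s.setMem a v).mem a' = if a' = a then v else s.mem a' := by
  simp [State.setMem, Function.update_apply]

end

/-- Total correctness: started in `s`, the program `c` halts within `T` steps in a state that
satisfies `Q`. -/
def WP (O : Oracle) (c : Cmd) (T : ℕ) (Q : State → Prop) (s : State) : Prop :=
  ∃ t s', t ≤ T ∧ Exec O c s t s' ∧ Q s'

namespace WP

theorem mono (h : WP O c T Q s) {T' : ℕ} (hT : T ≤ T') (hQ : ∀ s', Q s' → Q' s') :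
    WP O c T' Q' s := by
  obtain ⟨t, s', ht, he, hq⟩ := h
  exact ⟨t, s', ht.trans hT, he, hQ s' hq⟩

theorem skip (h : Q s) : WP O .skip 1 Q s := ⟨1, s, le_rfl, .skip s, h⟩

theorem const {r k : ℕ} (h : Q (s.setReg r k)) : WP O (.const r k) 1 Q s :=
  ⟨1, _, le_rfl, .const s r k, h⟩

theorem add {r x y : ℕ} (h : Q (s.setReg r (s.reg x + s.reg y))) : WP O (.add r x y) 1 Q s :=
  ⟨1, _, le_rfl, .add s r x y, h⟩

theorem sub {r x y : ℕ} (h : Q (s.setReg r (s.reg x - s.reg y))) : WP O (.sub r x y) 1 Q s :=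
  ⟨1, _, le_rfl, .sub s r x y, h⟩

theorem load {r x : ℕ} (h : Q (s.setReg r (s.mem (s.reg x)))) : WP O (.load r x) 1 Q s :=
  ⟨1, _, le_rfl, .load s r x, h⟩

theorem store {r x : ℕ} (h : Q (s.setMem (s.reg x) (s.reg r))) : WP O (.store x r) 1 Q s :=
  ⟨1, _, le_rfl, .store s x r, h⟩

theorem query {r x l : ℕ}
    (h : Q (s.setReg r (if O (s.word (s.reg x) (s.reg l)) = true then 1 else 0))) :
    WP O (.query r x l) (s.reg l + 1) Q s :=
  ⟨_, _, le_rfl, .query s r x l, h⟩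

theorem seq (h : WP O c T₁ (WP O d T₂ Q) s) : WP O (c ;; d) (T₁ + T₂) Q s := by
  obtain ⟨t, s', ht, he, t', s'', ht', he', hq⟩ := h
  exact ⟨t + t', s'', add_le_add ht ht', .seq he he', hq⟩

/-- Composition in terms of an intermediate assertion `Q'`, for steps with a specification. -/
theorem seq_of (h : WP O c T₁ Q' s) (h' : ∀ s', Q' s' → WP O d T₂ Q s') :
    WP O (c ;; d) (T₁ + T₂) Q s :=
  seq (h.mono le_rfl h')

theorem const_seq {r k : ℕ} (h : WP O d T Q (s.setReg r k)) :
    WP O (.const r k ;; d) (T + 1) Q s := add_comm 1 T ▸ seq (const h)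

theorem add_seq {r x y : ℕ} (h : WP O d T Q (s.setReg r (s.reg x + s.reg y))) :
    WP O (.add r x y ;; d) (T + 1) Q s := add_comm 1 T ▸ seq (add h)

theorem sub_seq {r x y : ℕ} (h : WP O d T Q (s.setReg r (s.reg x - s.reg y))) :
    WP O (.sub r x y ;; d) (T + 1) Q s := add_comm 1 T ▸ seq (sub h)

theorem load_seq {r x : ℕ} (h : WP O d T Q (s.setReg r (s.mem (s.reg x)))) :
    WP O (.load r x ;; d) (T + 1) Q s := add_comm 1 T ▸ seq (load h)

theorem store_seq {r x : ℕ} (h : WP O d T Q (s.setMem (s.reg x) (s.reg r))) :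
    WP O (.store x r ;; d) (T + 1) Q s := add_comm 1 T ▸ seq (store h)

theorem ifNZ {r : ℕ} (h : s.reg r ≠ 0 → WP O c T Q s) (h' : s.reg r = 0 → WP O d T Q s) :
    WP O (.ifNZ r c d) (T + 1) Q s := by
  by_cases hr : s.reg r = 0
  · obtain ⟨t, s', ht, he, hq⟩ := h' hr
    exact ⟨t + 1, s', by omega, .ifFalse hr he, hq⟩
  · obtain ⟨t, s', ht, he, hq⟩ := h hr
    exact ⟨t + 1, s', by omega, .ifTrue hr he, hq⟩

end WP

/-- Run `c` with register `i` equal to `0, 1, …, N - 1`, where `N` is the contents of register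
`lim`. Register `i + 1` is used for the loop test, and register `2` has to contain `1`. -/
def forLoop (i lim : ℕ) (c : Cmd) : Cmd :=
  .const i 0 ;; .sub (i + 1) lim i ;;
    .whileNZ (i + 1) (c ;; .add i i 2 ;; .sub (i + 1) lim i)

/-- The rule for counting loops with invariant `Inv`. -/
theorem WP.forLoop {i lim N : ℕ} (Inv : ℕ → State → Prop) (hi : 2 < i) (hlim : lim < i)
    (hN : s.reg lim = N) (hone : s.reg 2 = 1) (h0 : Inv 0 s)
    (hInv : ∀ j s r v, i ≤ r → Inv j s → Inv j (s.setReg r v))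
    (hbody : ∀ j s, j < N → Inv j s → s.reg i = j → s.reg lim = N → s.reg 2 = 1 →
      WP O c T (fun s' => Inv (j + 1) s' ∧ s'.reg i = j ∧ s'.reg lim = N ∧ s'.reg 2 = 1) s)
    (hQ : ∀ s, Inv N s → Q s) : WP O (forLoop i lim c) (N * (T + 3) + 3) Q s := by
  have main : ∀ l j s, j + l = N → Inv j s → s.reg i = j → s.reg (i + 1) = l →
      s.reg lim = N → s.reg 2 = 1 →
      WP O (.whileNZ (i + 1) (c ;; .add i i 2 ;; .sub (i + 1) lim i)) (l * (T + 3) + 1) Q s := by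
    intro l
    induction l with
    | zero =>
      intro j s hj hs _ hl _ _
      obtain rfl : j = N := hj
      exact ⟨1, s, by omega, .whileDone hl, hQ s hs⟩
    | succ l ih =>
      intro j s hj hs hij hl hlN h1
      obtain ⟨t, s', ht, he, hs', hi', hN', h1'⟩ := hbody j s (by omega) hs hij hlN h1
      have hnext := ih (j + 1)
        ((s'.setReg i (j + 1)).setReg (i + 1) (N - (j + 1))) (by omega)
        (hInv _ _ _ _ (by omega) (hInv _ _ _ _ le_rfl hs')) (by simp)
        (by simp; omega) (by simp [show lim ≠ i + 1 by omega, show lim ≠ i by omega, hN'])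
        (by simp [show 2 ≠ i + 1 by omega, show 2 ≠ i by omega, h1'])
      obtain ⟨t', s'', ht', he', hq⟩ := hnext
      refine ⟨(t + (1 + 1)) + t' + 1, s'', ?_, .whileStep (by omega)
        (.seq he (.seq (.add _ _ _ _) (.sub _ _ _ _))) ?_, hq⟩
      · rw [Nat.succ_mul]; omega
      · simpa [hi', hN', h1', show lim ≠ i by omega] using he'
  refine ((main N 0 ((s.setReg i 0).setReg (i + 1) N) (by omega)
    (hInv _ _ _ _ (by omega) (hInv _ _ _ _ le_rfl h0)) (by simp) (by simp)
    (by simp [show lim ≠ i + 1 by omega, show lim ≠ i by omega, hN])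
    (by simp [show 2 ≠ i + 1 by omega, show 2 ≠ i by omega, hone])) |> fun h => ?_)
  refine WP.const_seq (T := N * (T + 3) + 2) (WP.sub_seq ?_)
  simpa [hN, show lim ≠ i by omega] using h

/-- The registers below `b` have the same contents in both states. A program fragment is specified
to preserve all registers below some `b`, and keeps its own variables in registers from `b` on. -/
def AgreeBelow (b : ℕ) (s s' : State) : Prop := ∀ r < b, s'.reg r = s.reg r

@[simp] theorem AgreeBelow.refl : AgreeBelow b s s := fun _ _ => rfl

theorem AgreeBelow.trans (h : AgreeBelow b s₀ s₁) (h' : AgreeBelow b s₁ s₂) :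
    AgreeBelow b s₀ s₂ := fun r hr => (h' r hr).trans (h r hr)

theorem AgreeBelow.mono {b' : ℕ} (h : AgreeBelow b s₀ s₁) (hb : b' ≤ b) : AgreeBelow b' s₀ s₁ :=
  fun r hr => h r (hr.trans_le hb)

@[simp] theorem agreeBelow_setReg {r v : ℕ} (h : b ≤ r) :
    AgreeBelow b s₀ (s.setReg r v) ↔ AgreeBelow b s₀ s :=
  forall₂_congr fun x hx => by simp [show x ≠ r by omega]

@[simp] theorem agreeBelow_setMem {a v : ℕ} :
    AgreeBelow b s₀ (s.setMem a v) ↔ AgreeBelow b s₀ s := Iff.rfl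

/-- The memories agree outside the segment of length `N` at address `a`. -/
def AgreeOff (a N : ℕ) (μ μ' : ℕ → ℕ) : Prop := ∀ x, x < a ∨ a + N ≤ x → μ' x = μ x

@[simp] theorem AgreeOff.refl {a N : ℕ} {μ : ℕ → ℕ} : AgreeOff a N μ μ := fun _ _ => rfl

theorem AgreeOff.trans {a N : ℕ} {μ₀ μ₁ μ₂ : ℕ → ℕ} (h : AgreeOff a N μ₀ μ₁)
    (h' : AgreeOff a N μ₁ μ₂) : AgreeOff a N μ₀ μ₂ := fun x hx => (h' x hx).trans (h x hx)

theorem AgreeOff.setMem {a N i v : ℕ} {μ : ℕ → ℕ} (h : AgreeOff a N μ s.mem) (hi : i < N) :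
    AgreeOff a N μ (s.setMem (a + i) v).mem := fun x hx => by
  rw [State.mem_setMem, if_neg (by omega), h x hx]

/-! ### Arithmetic and arrays -/

/-- With `N` in register `3`, copy the array of length `N` at the address in register `src` to the
address in register `dst`. -/
def copyCmd (src dst : ℕ) : Cmd :=
  forLoop 40 3 (.add 42 src 40 ;; .load 43 42 ;; .add 42 dst 40 ;; .store 42 43)

theorem WP.copyCmd {src dst N A B : ℕ} (hsrc : src < 40) (hdst : dst < 40) (h1 : s.reg 2 = 1)
    (hN : s.reg 3 = N) (hA : s.reg src = A) (hB : s.reg dst = B) (hAB : A + N ≤ B ∨ B + N ≤ A) :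
    WP O (copyCmd src dst) (N * 7 + 3) (fun s' => AgreeBelow 40 s s' ∧
      (∀ i < N, s'.mem (B + i) = s.mem (A + i)) ∧ AgreeOff B N s.mem s'.mem) s := by
  refine WP.forLoop (T := 4) (fun j s' => AgreeBelow 40 s s' ∧
      (∀ i < j, s'.mem (B + i) = s.mem (A + i)) ∧ AgreeOff B N s.mem s'.mem)
    (by norm_num) (by norm_num) hN h1 (by simp) ?_ ?_ fun _ h => h
  · intro j s' r v hr h
    simpa [hr] using h
  · rintro j s' hj ⟨hs, hcp, hoff⟩ hi h3 h2
    have hA' : s'.reg src = A := (hs src hsrc).trans hA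
    have hB' : s'.reg dst = B := (hs dst hdst).trans hB
    refine WP.add_seq (WP.load_seq (WP.add_seq (WP.store ?_)))
    simp only [State.reg_setReg, State.mem_setReg, State.reg_setMem, hi, hA', hB',
      show dst ≠ 42 by omega, show dst ≠ 43 by omega, if_true, if_false, Nat.reduceEqDiff, h3, h2]
    refine ⟨⟨by simpa using hs, fun i hij => ?_, ?_⟩, by simp, by simp, by simp⟩
    · rw [State.mem_setMem]
      simp only [State.mem_setReg, Nat.add_left_cancel_iff]
      split_ifs with hij'
      · subst hij'
        exact hoff _ (by omega)
      · exact hcp i (by omega)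
    · exact AgreeOff.setMem (by simpa using hoff) hj

/-- With `N` in register `3`, put the sum of the array of length `N` at the address in register
`base` into register `30`. -/
def sumCmd (base : ℕ) : Cmd :=
  .const 30 0 ;; forLoop 40 3 (.add 42 base 40 ;; .load 42 42 ;; .add 30 30 42)

theorem WP.sumCmd {base N A : ℕ} (hbase : base < 30) (h1 : s.reg 2 = 1)
    (hN : s.reg 3 = N) (hA : s.reg base = A) :
    WP O (sumCmd base) (N * 6 + 4) (fun s' => AgreeBelow 30 s s' ∧ s'.mem = s.mem ∧
      s'.reg 30 = ∑ i ∈ Finset.range N, s.mem (A + i)) s := by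
  refine WP.const_seq (T := N * 6 + 3) (WP.forLoop (T := 3) (fun j s' => AgreeBelow 30 s s' ∧
      s'.mem = s.mem ∧ s'.reg 30 = ∑ i ∈ Finset.range j, s.mem (A + i))
    (by norm_num) (by norm_num) (by simpa using hN) (by simpa using h1) (by simp) ?_ ?_
    fun _ h => h)
  · intro j s' r v hr h
    simpa [show 30 ≤ r by omega, show 30 ≠ r by omega] using h
  · rintro j s' hj ⟨hs, hmem, hsum⟩ hi h3 h2
    have hA' : s'.reg base = A := (hs base hbase).trans hA
    refine WP.add_seq (WP.load_seq (WP.add ?_))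
    refine ⟨⟨by simpa using hs, hmem, ?_⟩, by simp [hi], by simp [h3], by simp [h2]⟩
    simp [hA', hi, hsum, hmem, Finset.sum_range_succ]

/-- Put `x % d` into register `50`, where `x` and `d` are the contents of the registers named. -/
def modCmd (x d : ℕ) : Cmd :=
  .const 50 0 ;; forLoop 51 x (.add 50 50 2 ;; .sub 53 d 50 ;; .ifNZ 53 .skip (.const 50 0))

theorem WP.modCmd {x d X D N : ℕ} (hx : x < 50) (hd : d < 50) (h1 : s.reg 2 = 1)
    (hX : s.reg x = X) (hD : s.reg d = D) (hD0 : 0 < D) (hXN : X ≤ N) :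
    WP O (modCmd x d) (N * 7 + 4) (fun s' => AgreeBelow 50 s s' ∧ s'.mem = s.mem ∧
      s'.reg 50 = X % D) s := by
  refine WP.mono (T := X * 7 + 4) ?_ (by omega) fun _ h => h
  refine WP.const_seq (T := X * 7 + 3) (WP.forLoop (T := 4) (fun j s' => AgreeBelow 50 s s' ∧
      s'.mem = s.mem ∧ s'.reg 50 = j % D)
    (by norm_num) (by omega) (by simpa [show x ≠ 50 by omega] using hX) (by simpa using h1)
    (by simp) ?_ ?_ fun _ h => h)
  · intro j s' r v hr h
    simpa [show 50 ≤ r by omega, show 50 ≠ r by omega] using h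
  · rintro j s' hj ⟨hs, hmem, hmod⟩ hi hx' h2
    have hD' : s'.reg d = D := (hs d hd).trans hD
    have hlt : j % D < D := Nat.mod_lt j hD0
    have hdne : d ≠ 50 := by omega
    have hxne : x ≠ 50 ∧ x ≠ 53 := by omega
    refine WP.add_seq (WP.sub_seq (WP.ifNZ (T := 1) (fun h => WP.skip ?_) fun h => WP.const ?_))
    · simp [hD', hmod, h2, hdne] at h
      refine ⟨⟨by simpa using hs, hmem, ?_⟩, by simp [hi], by simp [hx', hxne], by simp [h2]⟩
      have : j % D + 1 = (j + 1) % D := by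
        rw [Nat.add_mod, Nat.mod_eq_of_lt (show 1 < D by omega),
          Nat.mod_eq_of_lt (show j % D + 1 < D by omega)]
      simp [hmod, h2, this]
    · simp [hD', hmod, h2, hdne] at h
      refine ⟨⟨by simpa using hs, hmem, ?_⟩, by simp [hi], by simp [hx', hxne], by simp [h2]⟩
      have : (j + 1) % D = 0 := by
        have hj' : j + 1 = D * (j / D) + D := by
          have := Nat.div_add_mod j D
          omega
        rw [hj', Nat.add_mod_right, Nat.mul_mod_right]
      simp [this]

/-- With `N`, `K`, `M` in the registers `3`, `7`, `8` and `x` in register `30`, put a nonzero number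
into register `31` if `AvoidsDivisors K M x` holds, and `0` otherwise. -/
def testCmd : Cmd :=
  .const 31 1 ;; forLoop 40 3 (.ifNZ 40 (.sub 42 7 40 ;; .ifNZ 42 (.add 43 40 2 ;; modCmd 8 43 ;;
    .ifNZ 50 .skip (modCmd 30 43 ;; .ifNZ 50 .skip (.const 31 0))) .skip) .skip)

theorem WP.testCmd {N K M x : ℕ} (h1 : s.reg 2 = 1) (hN : s.reg 3 = N) (hK : s.reg 7 = K)
    (hM : s.reg 8 = M) (hx : s.reg 30 = x) (hMN : M ≤ N) (hx0 : 0 < x) (hxN : x ≤ N) :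
    WP O testCmd (N * (N * 14 + 18) + 4) (fun s' => AgreeBelow 31 s s' ∧ s'.mem = s.mem ∧
      (s'.reg 31 ≠ 0 ↔ AvoidsDivisors K M x)) s := by
  refine WP.const_seq (T := N * (N * 14 + 15 + 3) + 3) (WP.forLoop (fun j s' =>
      AgreeBelow 31 s s' ∧ s'.mem = s.mem ∧
        (s'.reg 31 ≠ 0 ↔ ∀ d, 2 ≤ d → d ≤ j → d ≤ K → d ∣ M → ¬ d ∣ x))
    (by norm_num) (by norm_num) (by simpa using hN) (by simpa using h1) ?_ ?_ ?_ ?_)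
  · refine ⟨by simp, rfl, ?_⟩
    simp
    intro d h h'
    omega
  · intro j s' r v hr h
    simpa [show 31 ≤ r by omega, show 31 ≠ r by omega] using h
  · rintro j s' hj ⟨hs, hmem, hgood⟩ hi h3 h2
    have h7 : s'.reg 7 = K := (hs 7 (by norm_num)).trans hK
    have h8 : s'.reg 8 = M := (hs 8 (by norm_num)).trans hM
    have h30 : s'.reg 30 = x := (hs 30 (by norm_num)).trans hx
    -- The divisor `j + 1` leaves the verdict unchanged unless it is at least `2`, at most `K`, and
    -- divides both numbers.
    have hsame : ¬ (2 ≤ j + 1 ∧ j + 1 ≤ K ∧ j + 1 ∣ M ∧ j + 1 ∣ x) →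
        ((∀ d, 2 ≤ d → d ≤ j → d ≤ K → d ∣ M → ¬ d ∣ x) ↔
          ∀ d, 2 ≤ d → d ≤ j + 1 → d ≤ K → d ∣ M → ¬ d ∣ x) := by
      intro hj'
      refine ⟨fun h d hd hdj hdK hdM hdx => ?_, fun h d hd hdj => h d hd (by omega)⟩
      rcases Nat.lt_or_ge j d with hlt | hge
      · obtain rfl : d = j + 1 := by omega
        exact hj' ⟨hd, hdK, hdM, hdx⟩
      · exact h d hd hge hdK hdM hdx
    refine WP.ifNZ (T := N * 14 + 14) (fun hj0 => WP.sub_seq (WP.ifNZ (T := N * 14 + 12)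
      (fun hjK => ?_) fun hjK => ?_)) fun hj0 => ?_
    · simp [h7, hi] at hjK
      rw [hi] at hj0
      refine WP.mono (T := (N * 7 + 4 + (N * 7 + 4 + 2 + 1)) + 1) (WP.add_seq (WP.seq_of
        (WP.modCmd (X := M) (D := j + 1) (N := N) (by norm_num) (by norm_num) (by simpa using h2)
          (by simpa using h8) (by simp [hi, h2]) (by omega) hMN) ?_)) (by omega) fun _ h => h
      rintro s₁ ⟨hs₁, hmem₁, hmod₁⟩
      have hs₁' : AgreeBelow 42 s' s₁ := fun r hr => by
        rw [hs₁ r (by omega)]; simp [show r ≠ 42 by omega, show r ≠ 43 by omega]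
      have h43 : s₁.reg 43 = j + 1 := by rw [hs₁ 43 (by norm_num)]; simp [hi, h2]
      refine WP.ifNZ (fun hM0 => ?_) fun hM0 => ?_
      · refine (WP.skip ?_).mono (by omega) fun _ h => h
        refine ⟨⟨hs.trans (hs₁'.mono (by norm_num)), hmem₁.trans hmem, ?_⟩, ?_, ?_, ?_⟩
        · rw [hs₁' 31 (by norm_num), hgood]
          exact hsame fun h => hM0 (hmod₁ ▸ Nat.mod_eq_zero_of_dvd h.2.2.1)
        · rw [hs₁' 40 (by norm_num), hi]
        · rw [hs₁' 3 (by norm_num), h3]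
        · rw [hs₁' 2 (by norm_num), h2]
      · refine WP.seq_of (T₁ := N * 7 + 4) (T₂ := 2) (WP.modCmd (x := 30) (d := 43)
          (X := x) (D := j + 1) (N := N) (by norm_num) (by norm_num)
          (by rw [hs₁' 2 (by norm_num), h2]) (by rw [hs₁' 30 (by norm_num), h30]) h43
          (by omega) hxN) ?_
        rintro s₂ ⟨hs₂, hmem₂, hmod₂⟩
        have hs₂' : AgreeBelow 42 s' s₂ := hs₁'.trans (hs₂.mono (by norm_num))
        refine WP.ifNZ (fun hx0 => WP.skip ?_) fun hx0 => WP.const ?_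
        · refine ⟨⟨hs.trans (hs₂'.mono (by norm_num)), hmem₂.trans (hmem₁.trans hmem), ?_⟩,
            ?_, ?_, ?_⟩
          · rw [hs₂' 31 (by norm_num), hgood]
            exact hsame fun h => hx0 (hmod₂ ▸ Nat.mod_eq_zero_of_dvd h.2.2.2)
          · rw [hs₂' 40 (by norm_num), hi]
          · rw [hs₂' 3 (by norm_num), h3]
          · rw [hs₂' 2 (by norm_num), h2]
        · refine ⟨⟨?_, hmem₂.trans (hmem₁.trans hmem), ?_⟩, ?_, ?_, ?_⟩
          · simpa using hs.trans (hs₂'.mono (by norm_num))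
          · simp only [State.reg_setReg, if_true, ne_eq, not_true_eq_false, false_iff]
            intro h
            exact h (j + 1) (by omega) le_rfl (by omega) (Nat.dvd_of_mod_eq_zero (hmod₁ ▸ hM0))
              (Nat.dvd_of_mod_eq_zero (hmod₂ ▸ hx0))
          · simp [hs₂' 40 (by norm_num), hi]
          · simp [hs₂' 3 (by norm_num), h3]
          · simp [hs₂' 2 (by norm_num), h2]
    · simp [h7, hi] at hjK
      refine (WP.skip ?_).mono (by omega) fun _ h => h
      refine ⟨⟨by simpa using hs, hmem, ?_⟩, by simp [hi], by simp [h3], by simp [h2]⟩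
      simp only [State.reg_setReg, Nat.reduceEqDiff, if_false, hgood]
      exact hsame fun h => by omega
    · refine (WP.skip ?_).mono (by omega) fun _ h => h
      exact ⟨⟨hs, hmem, hgood.trans (hsame fun h => by omega)⟩, hi, h3, h2⟩
  · rintro s' ⟨hs, hmem, hgood⟩
    refine ⟨hs, hmem, hgood.trans ⟨fun h d hd hK hM hdx => ?_, fun h d hd _ => h d hd⟩⟩
    exact h d hd ((Nat.le_of_dvd hx0 hdx).trans hxN) hK hM hdx

/-! ### Subgroups of a group given by its Cayley table -/

section Group

variable {G : Type} {N : ℕ} {e : G ≃ Fin N} {μ μ' : ℕ → ℕ} {A T W D K M : ℕ} {S : Set G}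

/-- The Cayley table of `G`, with respect to the numbering `e`, is stored at address `T`. -/
def HasTable [Group G] (μ : ℕ → ℕ) (T : ℕ) (e : G ≃ Fin N) : Prop :=
  ∀ g h : G, μ (T + (e g * N + e h)) = e (g * h)

open Classical in
/-- The characteristic vector of `S` is stored at address `A`. -/
def HasSet (μ : ℕ → ℕ) (A : ℕ) (e : G ≃ Fin N) (S : Set G) : Prop :=
  ∀ g : G, μ (A + e g) = if g ∈ S then 1 else 0

theorem HasTable.congr [Group G] (h : HasTable μ T e)
    (hμ : ∀ x, T ≤ x → x < T + N * N → μ' x = μ x) :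
    HasTable μ' T e := fun a b => by
  rw [hμ _ (by omega), h]
  have h1 := (e a).2
  have h2 := (e b).2
  nlinarith

theorem HasSet.congr (h : HasSet μ A e S) (hμ : ∀ x, A ≤ x → x < A + N → μ' x = μ x) :
    HasSet μ' A e S := fun a => by
  rw [hμ _ (by omega) (by omega), h]

theorem HasSet.ne_zero_iff (h : HasSet μ A e S) (g : G) : μ (A + e g) ≠ 0 ↔ g ∈ S := by
  rw [h g]
  split_ifs with hg <;> simp [hg]

theorem HasSet.eq_zero_iff (h : HasSet μ A e S) (g : G) : μ (A + e g) = 0 ↔ g ∉ S := by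
  rw [← h.ne_zero_iff, not_not]

theorem HasSet.insert (h : HasSet s.mem A e S) (g : G) :
    HasSet (s.setMem (A + e g) 1).mem A e (insert g S) := fun x => by
  rw [State.mem_setMem, h x]
  by_cases hx : x = g
  · rw [hx, if_pos rfl, if_pos (Set.mem_insert g S)]
  · rw [if_neg fun h' => hx (e.injective (Fin.val_injective (Nat.add_left_cancel h')))]
    by_cases hxS : x ∈ S
    · rw [if_pos hxS, if_pos (Set.mem_insert_of_mem g hxS)]
    · rw [if_neg hxS, if_neg fun h => h.elim hx hxS]

theorem HasSet.sum_eq (h : HasSet μ A e S) : ∑ i ∈ Finset.range N, μ (A + i) = S.ncard := by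
  classical
  have : Fintype G := Fintype.ofEquiv _ e.symm
  rw [← Fin.sum_univ_eq_sum_range (fun i => μ (A + i)), ← Equiv.sum_comp e]
  simp only [h _]
  rw [Finset.sum_boole, ← Set.ncard_coe_finset]
  simp

variable [Group G]

/-- One round of closing under multiplication the set stored at the address in register `6`: with
the order of the group in register `3` and the address of the Cayley table in register `4`, run
through the table and add the product of any two elements that are found in the set. Register `34`,
cleared by subtracting it from itself, points into the table. -/
def sweepCmd : Cmd :=
  .sub 34 34 34 ;; .add 34 34 4 ;; forLoop 35 3 (forLoop 37 3 (.load 39 34 ;; .add 34 34 2 ;;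
    .add 40 6 35 ;; .load 40 40 ;; .ifNZ 40 (.add 40 6 37 ;; .load 40 40 ;;
      .ifNZ 40 (.add 40 6 39 ;; .store 40 2) .skip) .skip))

theorem WP.sweepCmd (h1 : s.reg 2 = 1) (hN : s.reg 3 = N) (hT : s.reg 4 = T) (hW : s.reg 6 = W)
    (htab : HasTable s.mem T e) (hTW : T + N * N ≤ W) (hS : HasSet s.mem W e S) :
    WP O sweepCmd (N * (N * 13 + 6) + 5) (fun s' => AgreeBelow 34 s s' ∧
      AgreeOff W N s.mem s'.mem ∧ ∃ S' : Set G, HasSet s'.mem W e S' ∧ S ⊆ S' ∧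
        S' ⊆ Subgroup.closure S ∧ ∀ a ∈ S, ∀ b ∈ S, a * b ∈ S') s := by
  have hlt : ∀ j < N, ∃ g, (e g : ℕ) = j := fun j hj => ⟨e.symm ⟨j, hj⟩, by simp⟩
  refine WP.sub_seq (T := N * (N * 13 + 6) + 4) (WP.add_seq (T := N * (N * 13 + 3 + 3) + 3)
    (WP.forLoop (fun i s' => AgreeBelow 34 s s' ∧ s'.reg 34 = T + i * N ∧
      AgreeOff W N s.mem s'.mem ∧ ∃ S' : Set G, HasSet s'.mem W e S' ∧ S ⊆ S' ∧
        S' ⊆ Subgroup.closure S ∧ ∀ a ∈ S, ∀ b ∈ S, (e a : ℕ) < i → a * b ∈ S')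
    (by norm_num) (by norm_num) (by simpa using hN) (by simpa using h1) ?_ ?_ ?_ ?_))
  · exact ⟨by simp, by simp [hT], by simp, S, hS, subset_rfl, Subgroup.subset_closure,
      fun _ _ _ _ h => absurd h (Nat.not_lt_zero _)⟩
  · intro j s' r v hr h
    simpa [show 34 ≤ r by omega, show 34 ≠ r by omega] using h
  · rintro i s₁ hi ⟨hs₁, hp₁, hoff₁, S₁, hS₁, hSS₁, hS₁S, hcl₁⟩ hi₁ h3₁ h2₁
    refine WP.forLoop (T := 10) (fun j s' => AgreeBelow 34 s s' ∧ s'.reg 35 = i ∧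
      s'.reg 34 = T + (i * N + j) ∧
      AgreeOff W N s.mem s'.mem ∧ ∃ S' : Set G, HasSet s'.mem W e S' ∧ S ⊆ S' ∧
        S' ⊆ Subgroup.closure S ∧
        ∀ a ∈ S, ∀ b ∈ S, ((e a : ℕ) < i ∨ (e a : ℕ) = i ∧ (e b : ℕ) < j) → a * b ∈ S')
      (by norm_num) (by norm_num) h3₁ h2₁
      ⟨hs₁, hi₁, hp₁, hoff₁, S₁, hS₁, hSS₁, hS₁S, fun a ha b hb h => hcl₁ a ha b hb (by omega)⟩
      ?_ ?_ ?_
    · intro j s' r v hr h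
      simpa [show 34 ≤ r by omega, show 34 ≠ r by omega, show 35 ≠ r by omega] using h
    · rintro j s₂ hj ⟨hs₂, hi₂, hp₂, hoff₂, S₂, hS₂, hSS₂, hS₂S, hcl₂⟩ hj₂ h3₂ h2₂
      obtain ⟨a, rfl⟩ := hlt i hi
      obtain ⟨b, rfl⟩ := hlt j hj
      have h6 : s₂.reg 6 = W := (hs₂ 6 (by norm_num)).trans hW
      have hab : s₂.mem (T + (e a * N + e b)) = e (a * b) := by
        rw [hoff₂ _ (.inl (by nlinarith)), htab]
      -- Whichever branch is taken, it is enough that the product is in the set if both factors are.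
      have hstep : ∀ {S' : Set G}, S₂ ⊆ S' → (a ∈ S₂ → b ∈ S₂ → a * b ∈ S') →
          ∀ x ∈ S, ∀ y ∈ S, ((e x : ℕ) < e a ∨ (e x : ℕ) = e a ∧ (e y : ℕ) < e b + 1) →
            x * y ∈ S' := by
        intro S' hS' hab' x hx y hy hxy
        by_cases h : x = a ∧ y = b
        · rw [h.1, h.2]
          exact hab' (hSS₂ (h.1 ▸ hx)) (hSS₂ (h.2 ▸ hy))
        · refine hS' (hcl₂ x hx y hy ?_)
          simp only [← Fin.val_inj.trans e.apply_eq_iff_eq] at h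
          omega
      refine WP.load_seq (WP.add_seq (WP.add_seq (WP.load_seq (WP.ifNZ (T := 5) (fun ha => ?_)
        fun ha => (WP.skip ?_).mono (by norm_num) fun _ h => h))))
      · refine WP.add_seq (WP.load_seq (WP.ifNZ (T := 2) (fun hb => WP.add_seq (WP.store ?_))
          fun hb => (WP.skip ?_).mono (by norm_num) fun _ h => h))
        · simp [h6, hi₂, hS₂.ne_zero_iff, -ne_eq] at ha
          simp [h6, hj₂, hS₂.ne_zero_iff, -ne_eq] at hb
          simp only [State.reg_setReg, State.mem_setReg, State.reg_setMem, Nat.reduceEqDiff,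
            if_true, if_false, h6, hp₂, hab, h2₂]
          refine ⟨⟨by simpa using hs₂, by simp [hi₂], by simp [add_assoc],
            AgreeOff.setMem (by simpa using hoff₂) (e (a * b)).2, insert (a * b) S₂,
            HasSet.insert (by simpa using hS₂) _, hSS₂.trans (Set.subset_insert _ _),
            Set.insert_subset (mul_mem (hS₂S ha) (hS₂S hb)) hS₂S,
            hstep (Set.subset_insert _ _) fun _ _ => Set.mem_insert _ _⟩,
            by simp [hj₂], by simp [h3₂], by simp⟩
        · simp [h6, hj₂, hS₂.eq_zero_iff] at hb
          exact ⟨⟨by simpa using hs₂, by simp [hi₂], by simp [hp₂, h2₂, add_assoc], hoff₂, S₂, hS₂,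
            hSS₂, hS₂S, hstep subset_rfl fun _ h => (hb h).elim⟩,
            by simp [hj₂], by simp [h3₂], by simp [h2₂]⟩
      · simp [h6, hi₂, hS₂.eq_zero_iff] at ha
        exact ⟨⟨by simpa using hs₂, by simp [hi₂], by simp [hp₂, h2₂, add_assoc], hoff₂, S₂, hS₂,
          hSS₂, hS₂S, hstep subset_rfl fun h => (ha h).elim⟩,
          by simp [hj₂], by simp [h3₂], by simp [h2₂]⟩
    · rintro s₂ ⟨hs₂, hi₂, hp₂, hoff₂, S₂, hS₂, hSS₂, hS₂S, hcl₂⟩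
      exact ⟨⟨hs₂, by rw [hp₂]; ring, hoff₂, S₂, hS₂, hSS₂, hS₂S,
        fun a ha b hb h => hcl₂ a ha b hb (by omega)⟩, hi₂,
        (hs₂ 3 (by norm_num)).trans hN, (hs₂ 2 (by norm_num)).trans h1⟩
  · rintro s' ⟨hs, -, hoff, S', hS', hSS', hS'S, hcl⟩
    exact ⟨hs, hoff, S', hS', hSS', hS'S, fun a ha b hb => hcl a ha b hb (e a).2⟩

/-- Replace the set stored at the address in register `6` by the subgroup that it generates. -/
def closureCmd : Cmd := forLoop 32 3 sweepCmd

/-- `N` rounds of `sweepCmd` are enough, since a round that does not produce the whole closure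
produces at least one new element. -/
theorem WP.closureCmd (h1 : s.reg 2 = 1) (hN : s.reg 3 = N) (hT : s.reg 4 = T) (hW : s.reg 6 = W)
    (htab : HasTable s.mem T e) (hTW : T + N * N ≤ W) (hS : HasSet s.mem W e S)
    (hne : S.Nonempty) :
    WP O closureCmd (N * (N * (N * 13 + 6) + 8) + 3) (fun s' => AgreeBelow 32 s s' ∧
      AgreeOff W N s.mem s'.mem ∧ HasSet s'.mem W e (Subgroup.closure S : Set G)) s := by
  have hfin : Finite G := Finite.of_equiv _ e.symm
  refine WP.forLoop (T := N * (N * 13 + 6) + 5) (fun r s' => AgreeBelow 32 s s' ∧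
      AgreeOff W N s.mem s'.mem ∧ ∃ S' : Set G, HasSet s'.mem W e S' ∧ S ⊆ S' ∧
        S' ⊆ Subgroup.closure S ∧ (S' = Subgroup.closure S ∨ r + 1 ≤ S'.ncard))
    (by norm_num) (by norm_num) hN h1 ?_ ?_ ?_ ?_
  · exact ⟨by simp, by simp, S, hS, subset_rfl, Subgroup.subset_closure,
      .inr ((Set.ncard_pos (Set.toFinite S)).2 hne)⟩
  · intro j s' r v hr h
    simpa [hr] using h
  · rintro r s₁ hr ⟨hs₁, hoff₁, S₁, hS₁, hSS₁, hS₁S, hcard⟩ hr₁ h3₁ h2₁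
    have htab₁ : HasTable s₁.mem T e := htab.congr fun x _ hx => hoff₁ x (by omega)
    refine (WP.sweepCmd h2₁ h3₁ ((hs₁ 4 (by norm_num)).trans hT)
      ((hs₁ 6 (by norm_num)).trans hW) htab₁ hTW hS₁).mono le_rfl ?_
    rintro s₂ ⟨hs₂, hoff₂, S₂, hS₂, hSS₂, hS₂S, hmul⟩
    have hS₂S' : S₂ ⊆ Subgroup.closure S :=
      hS₂S.trans ((Subgroup.closure_le _).2 hS₁S)
    refine ⟨⟨hs₁.trans (hs₂.mono (by norm_num)), hoff₁.trans hoff₂, S₂, hS₂, hSS₁.trans hSS₂,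
      hS₂S', ?_⟩, (hs₂ 32 (by norm_num)).trans hr₁, (hs₂ 3 (by norm_num)).trans h3₁,
      (hs₂ 2 (by norm_num)).trans h2₁⟩
    by_cases heq : S₁ = Subgroup.closure S
    · exact .inl (hS₂S'.antisymm (heq ▸ hSS₂))
    · have hlt : S₁.ncard < S₂.ncard := by
        refine Set.ncard_lt_ncard (hSS₂.ssubset_of_ne fun h => heq ?_) (Set.toFinite _)
        exact eq_closure_of_mul_subset hne hSS₁ hS₁S fun a ha b hb => h ▸ hmul a ha b hb
      have := hcard.resolve_left heq
      exact .inr (by omega)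
  · rintro s' ⟨hs, hoff, S', hS', -, -, hcard⟩
    refine ⟨hs, hoff, ?_⟩
    rcases hcard with rfl | hcard
    · exact hS'
    · have h1 : S'.ncard ≤ Nat.card G := by
        rw [← Set.ncard_univ]
        exact Set.ncard_le_ncard (Set.subset_univ _) (Set.toFinite _)
      have h2 : Nat.card G = N := by simpa using Nat.card_congr e
      omega

/-- Greedy computation of a subgroup `P` with `IsGreedyOutput K M P`: run through the elements `x` of
the group and enlarge the set at the address in register `5`, initially empty, to the subgroup
generated by it and `x` if the order of the latter satisfies `AvoidsDivisors K M`. The candidates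
are built at the address in register `6`. -/
def greedyCmd : Cmd :=
  forLoop 20 3 (copyCmd 5 6 ;; .add 22 6 20 ;; .store 22 2 ;; closureCmd ;; sumCmd 6 ;; testCmd ;;
    .ifNZ 31 (copyCmd 6 5) .skip)

/-- Running time of `greedyCmd` for a group of order `N`. -/
def greedyTime {R : Type*} [CommSemiring R] (N : R) : R :=
  N * (N * (N * (N * 13 + 6) + 8) + N * (N * 14 + 18) + N * 20 + 23) + 3

theorem WP.greedyCmd (h1 : s.reg 2 = 1) (hN : s.reg 3 = N) (hT : s.reg 4 = T) (hD : s.reg 5 = D)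
    (hW : s.reg 6 = W) (hK : s.reg 7 = K) (hM : s.reg 8 = M) (hMN : M ≤ N)
    (htab : HasTable s.mem T e) (hTD : T + N * N ≤ D) (hDW : D + N ≤ W)
    (hempty : HasSet s.mem D e (∅ : Set G)) :
    WP O greedyCmd (greedyTime N) (fun s' => AgreeBelow 20 s s' ∧
      (∀ x, x < D ∨ D + N ≤ x ∧ x < W → s'.mem x = s.mem x) ∧
      ∃ P : Subgroup G, IsGreedyOutput K M P ∧ HasSet s'.mem D e (P : Set G)) s := by
  have hfin : Finite G := Finite.of_equiv _ e.symm
  have hcard : Nat.card G = N := by simpa using Nat.card_congr e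
  refine WP.mono (T := N * ((N * 7 + 3) + (((N * (N * (N * 13 + 6) + 8) + 3) + ((N * 6 + 4) +
    ((N * (N * 14 + 18) + 4) + ((N * 7 + 3) + 1)))) + 1 + 1) + 3) + 3) ?_
    (le_of_eq (by unfold greedyTime; ring)) fun _ h => h
  refine WP.forLoop (fun j s' => AgreeBelow 20 s s' ∧
      (∀ x, x < D ∨ D + N ≤ x ∧ x < W → s'.mem x = s.mem x) ∧
      ∃ A : Set G, HasSet s'.mem D e A ∧ (A = ∅ ∨ A = Subgroup.closure A) ∧
        AvoidsDivisors K M (Nat.card (Subgroup.closure A)) ∧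
        ∀ y, (e y : ℕ) < j → AvoidsDivisors K M (Nat.card (Subgroup.closure (insert y A))) → y ∈ A)
    (by norm_num) (by norm_num) hN h1 ?_ ?_ ?_ ?_
  · refine ⟨by simp, fun _ _ => rfl, ∅, hempty, .inl rfl, ?_, fun _ h => absurd h (Nat.not_lt_zero _)⟩
    rw [Subgroup.closure_empty]
    exact AvoidsDivisors.card_bot
  · intro j s' r v hr h
    simpa [hr] using h
  · rintro j s₁ hj ⟨hs₁, hoff₁, A, hA, hAcl, hAgood, hAmax⟩ hj₁ h3₁ h2₁
    obtain ⟨g, rfl⟩ : ∃ g, (e g : ℕ) = j := ⟨e.symm ⟨j, hj⟩, by simp⟩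
    have h4₁ : s₁.reg 4 = T := (hs₁ 4 (by norm_num)).trans hT
    have h5₁ : s₁.reg 5 = D := (hs₁ 5 (by norm_num)).trans hD
    have h6₁ : s₁.reg 6 = W := (hs₁ 6 (by norm_num)).trans hW
    refine WP.seq_of (WP.copyCmd (by norm_num) (by norm_num) h2₁ h3₁ h5₁ h6₁ (.inl hDW)) ?_
    rintro s₂ ⟨hs₂, hcp₂, hoff₂⟩
    have h2₂ := (hs₂ 2 (by norm_num)).trans h2₁
    have h6₂ := (hs₂ 6 (by norm_num)).trans h6₁
    have hj₂ := (hs₂ 20 (by norm_num)).trans hj₁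
    refine WP.add_seq (WP.store_seq ?_)
    simp only [State.reg_setReg, Nat.reduceEqDiff, if_true, if_false, h2₂, h6₂, hj₂]
    set s₃ := (s₂.setReg 22 (W + e g)).setMem (W + e g) 1 with hs₃def
    have hs₃ : AgreeBelow 22 s₁ s₃ := by simpa [hs₃def] using hs₂.mono (by norm_num)
    have hA₂ : HasSet s₂.mem W e A := fun x => by rw [hcp₂ _ (e x).2, hA]
    have hA₃ : HasSet s₃.mem W e (insert g A) := HasSet.insert (by simpa using hA₂) g
    have hoff₃ : AgreeOff W N s₁.mem s₃.mem := AgreeOff.setMem (by simpa using hoff₂) (e g).2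
    refine WP.seq_of (WP.closureCmd (e := e) ((hs₃ 2 (by norm_num)).trans h2₁)
      ((hs₃ 3 (by norm_num)).trans h3₁) ((hs₃ 4 (by norm_num)).trans h4₁)
      ((hs₃ 6 (by norm_num)).trans h6₁) (htab.congr fun x _ hx => ?_) (by omega) hA₃
      (Set.insert_nonempty _ _)) ?_
    · rw [hoff₃ _ (by omega), hoff₁ _ (by omega)]
    rintro s₄ ⟨hs₄, hoff₄, hA₄⟩
    replace hs₄ := hs₃.trans (hs₄.mono (by norm_num))
    replace hoff₄ := hoff₃.trans hoff₄
    refine WP.seq_of (WP.sumCmd (by norm_num) ((hs₄ 2 (by norm_num)).trans h2₁)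
      ((hs₄ 3 (by norm_num)).trans h3₁) ((hs₄ 6 (by norm_num)).trans h6₁)) ?_
    rintro s₅ ⟨hs₅, hmem₅, hsum⟩
    rw [hA₄.sum_eq] at hsum
    replace hs₅ := hs₄.trans (hs₅.mono (by norm_num))
    refine WP.seq_of (WP.testCmd ((hs₅ 2 (by norm_num)).trans h2₁)
      ((hs₅ 3 (by norm_num)).trans h3₁)
      ((hs₅ 7 (by norm_num)).trans ((hs₁ 7 (by norm_num)).trans hK))
      ((hs₅ 8 (by norm_num)).trans ((hs₁ 8 (by norm_num)).trans hM)) hsum hMN ?_ ?_) ?_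
    · exact (Set.ncard_pos (Set.toFinite _)).2 ⟨1, Subgroup.one_mem _⟩
    · rw [← hcard, ← Set.ncard_univ]
      exact Set.ncard_le_ncard (Set.subset_univ _) (Set.toFinite _)
    rintro s₆ ⟨hs₆, hmem₆, hgood⟩
    replace hs₆ := hs₅.trans (hs₆.mono (by norm_num))
    rw [show (Subgroup.closure (insert g A) : Set G).ncard =
      Nat.card (Subgroup.closure (insert g A)) from (Nat.card_coe_set_eq _).symm] at hgood
    have hmem : s₆.mem = s₄.mem := hmem₆.trans hmem₅
    refine WP.ifNZ (fun h31 => ?_) fun h31 => (WP.skip ?_).mono (by omega) fun _ h => h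
    · refine (WP.copyCmd (by norm_num) (by norm_num) ((hs₆ 2 (by norm_num)).trans h2₁)
        ((hs₆ 3 (by norm_num)).trans h3₁) ((hs₆ 6 (by norm_num)).trans h6₁)
        ((hs₆ 5 (by norm_num)).trans h5₁) (.inr hDW)).mono le_rfl ?_
      rintro s₇ ⟨hs₇, hcp₇, hoff₇⟩
      replace hs₇ := hs₆.trans (hs₇.mono (by norm_num))
      refine ⟨⟨hs₁.trans (hs₇.mono (by norm_num)), fun x hx => ?_, Subgroup.closure (insert g A),
        fun x => ?_, .inr ?_, ?_, fun y hy hyg => ?_⟩, (hs₇ 20 (by norm_num)).trans hj₁,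
        (hs₇ 3 (by norm_num)).trans h3₁, (hs₇ 2 (by norm_num)).trans h2₁⟩
      · rw [hoff₇ x (by omega), hmem, hoff₄ x (by omega), hoff₁ x hx]
      · rw [hcp₇ _ (e x).2, hmem, hA₄ x]
      · rw [Subgroup.closure_eq]
      · rw [Subgroup.closure_eq]
        exact hgood.1 h31
      · have hsub : A ⊆ Subgroup.closure (insert g A) :=
          (Set.subset_insert _ _).trans Subgroup.subset_closure
        rcases Nat.lt_succ_iff_lt_or_eq.1 hy with hy | hy
        · exact hsub (hAmax y hy (hyg.of_le (Subgroup.closure_mono (Set.insert_subset_insert hsub))))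
        · rw [e.injective (Fin.val_injective hy)]
          exact Subgroup.subset_closure (Set.mem_insert _ _)
    · refine ⟨⟨hs₁.trans (hs₆.mono (by norm_num)), fun x hx => ?_, A,
        hA.congr fun x hx hx' => ?_, hAcl, hAgood, fun y hy hyg => ?_⟩,
        (hs₆ 20 (by norm_num)).trans hj₁,
        (hs₆ 3 (by norm_num)).trans h3₁, (hs₆ 2 (by norm_num)).trans h2₁⟩
      · rw [hmem, hoff₄ x (by omega), hoff₁ x hx]
      · rw [hmem, hoff₄ x (by omega)]
      · rcases Nat.lt_succ_iff_lt_or_eq.1 hy with hy | hy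
        · exact hAmax y hy hyg
        · rw [e.injective (Fin.val_injective hy)] at hyg
          exact absurd h31 (hgood.2 hyg)
  · rintro s' ⟨hs, hoff, A, hA, hAcl, hAgood, hAmax⟩
    refine ⟨hs, hoff, Subgroup.closure A, ⟨hAgood, fun X hX hXgood y hy => ?_⟩, ?_⟩
    · refine Subgroup.subset_closure (hAmax y (e y).2 (hXgood.of_le ?_))
      exact (Subgroup.closure_le X).2 (Set.insert_subset hy (Subgroup.subset_closure.trans hX))
    · -- The set is not empty, as it contains the identity.
      have h1A : (1 : G) ∈ A := by
        refine hAmax 1 (e 1).2 (hAgood.of_le ?_)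
        exact (Subgroup.closure_le _).2 (Set.insert_subset (Subgroup.one_mem _)
          Subgroup.subset_closure)
      rw [← hAcl.resolve_left (Set.Nonempty.ne_empty ⟨1, h1A⟩)]
      exact hA

end Group

/-! ### The reduction -/

/-- With `k` in register `1`, compute complementary Hall subgroups of the group in registers `3` and
`4`, for the primes greater than `k` and for the others, the second one as a maximal subgroup of
order coprime to that of the first. They are stored at the address in register `5`, which is
advanced past them. Register `9` has to contain `0`. -/
def hallPairCmd : Cmd :=
  .add 7 1 9 ;; .const 8 0 ;; greedyCmd ;; sumCmd 5 ;; .add 8 30 9 ;; .add 7 3 9 ;; .add 5 5 3 ;;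
    greedyCmd ;; .add 5 5 3

/-- Running time of `hallPairCmd` for a group of order `N`. -/
def hallPairTime {R : Type*} [CommSemiring R] (N : R) : R := 2 * greedyTime N + N * 6 + 10

theorem WP.hallPairCmd {G : Type} [Group G] [Group.IsSolvable G] {N : ℕ} {e : G ≃ Fin N}
    {k T D W : ℕ} (hk : s.reg 1 = k) (h1 : s.reg 2 = 1) (hN : s.reg 3 = N) (hT : s.reg 4 = T)
    (hD : s.reg 5 = D) (hW : s.reg 6 = W) (h9 : s.reg 9 = 0) (htab : HasTable s.mem T e)
    (hTD : T + N * N ≤ D) (hDW : D + N + N ≤ W)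
    (hzero : ∀ x, D ≤ x → x < D + N + N → s.mem x = 0) :
    WP O hallPairCmd (hallPairTime N) (fun s' =>
      (∀ r < 20, r ≠ 5 → r ≠ 7 → r ≠ 8 → s'.reg r = s.reg r) ∧ s'.reg 5 = D + N + N ∧
      (∀ x, x < D ∨ D + N + N ≤ x ∧ x < W → s'.mem x = s.mem x) ∧
      ∃ P₁ P₂ : Subgroup G, IsHall (fun p => k < p) P₁ ∧ IsHall (fun p => ¬ k < p) P₂ ∧
        HasSet s'.mem D e (P₁ : Set G) ∧ HasSet s'.mem (D + N) e (P₂ : Set G)) s := by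
  have hfin : Finite G := Finite.of_equiv _ e.symm
  have hcard : Nat.card G = N := by simpa using Nat.card_congr e
  have hN0 : ∀ g : G, (e g : ℕ) < N := fun g => (e g).2
  refine WP.mono (T := (greedyTime N + ((N * 6 + 4) + ((greedyTime N + 1) + 1 + 1 + 1))) + 1 + 1)
    ?_ (le_of_eq (by unfold hallPairTime; ring)) fun _ h => h
  refine WP.add_seq (WP.const_seq ?_)
  set s₁ := (s.setReg 7 (s.reg 1 + s.reg 9)).setReg 8 0 with hs₁
  refine WP.seq_of (WP.greedyCmd (e := e) (T := T) (D := D) (W := W) (K := k) (M := 0)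
    (by simpa [hs₁] using h1) (by simpa [hs₁] using hN) (by simpa [hs₁] using hT)
    (by simpa [hs₁] using hD) (by simpa [hs₁] using hW) (by simp [hs₁, hk, h9]) (by simp [hs₁])
    (Nat.zero_le _) (by simpa [hs₁] using htab) hTD (by omega) fun g => ?_) ?_
  · have := hN0 g
    simpa [hs₁] using hzero (D + e g) (by omega) (by omega)
  rintro s₂ ⟨hs₂, hmem₂, P₁, hP₁, hset₁⟩
  have hs₂' : ∀ r < 20, r ≠ 7 → r ≠ 8 → s₂.reg r = s.reg r := fun r hr h7 h8 => by
    rw [hs₂ r hr]; simp [hs₁, h7, h8]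
  have hmem₂' : ∀ x, x < D ∨ D + N ≤ x ∧ x < W → s₂.mem x = s.mem x := hmem₂
  refine WP.seq_of (WP.sumCmd (by norm_num) ((hs₂' 2 (by norm_num) (by norm_num)
    (by norm_num)).trans h1) ((hs₂' 3 (by norm_num) (by norm_num) (by norm_num)).trans hN)
    ((hs₂' 5 (by norm_num) (by norm_num) (by norm_num)).trans hD)) ?_
  rintro s₃ ⟨hs₃, hmem₃, hsum⟩
  rw [hset₁.sum_eq, show (P₁ : Set G).ncard = Nat.card P₁ from (Nat.card_coe_set_eq _).symm] at hsum
  have hs₃' : ∀ r < 20, r ≠ 7 → r ≠ 8 → s₃.reg r = s.reg r := fun r hr h7 h8 => by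
    rw [hs₃ r (by omega), hs₂' r hr h7 h8]
  have hN₃ : s₃.reg 3 = N := (hs₃' 3 (by norm_num) (by norm_num) (by norm_num)).trans hN
  have hD₃ : s₃.reg 5 = D := (hs₃' 5 (by norm_num) (by norm_num) (by norm_num)).trans hD
  have h9₃ : s₃.reg 9 = 0 := (hs₃' 9 (by norm_num) (by norm_num) (by norm_num)).trans h9
  refine WP.add_seq (WP.add_seq (WP.add_seq ?_))
  simp only [State.reg_setReg, Nat.reduceEqDiff, if_false, hN₃, hD₃, h9₃, hsum, add_zero]
  set s₄ := ((s₃.setReg 8 (Nat.card P₁)).setReg 7 N).setReg 5 (D + N) with hs₄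
  have hs₄' : ∀ r < 20, r ≠ 5 → r ≠ 7 → r ≠ 8 → s₄.reg r = s.reg r := fun r hr h5 h7 h8 => by
    rw [← hs₃' r hr h7 h8]; simp [hs₄, h5, h7, h8]
  have hmem₄ : ∀ x, x < D ∨ D + N ≤ x ∧ x < W → s₄.mem x = s.mem x := fun x hx => by
    rw [← hmem₂' x hx, ← hmem₃]; rfl
  refine WP.seq_of (WP.greedyCmd (e := e) (T := T) (D := D + N) (W := W) (K := Nat.card G)
    (M := Nat.card P₁)
    ((hs₄' 2 (by norm_num) (by norm_num) (by norm_num) (by norm_num)).trans h1)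
    ((hs₄' 3 (by norm_num) (by norm_num) (by norm_num) (by norm_num)).trans hN)
    ((hs₄' 4 (by norm_num) (by norm_num) (by norm_num) (by norm_num)).trans hT)
    (by simp [hs₄]) ((hs₄' 6 (by norm_num) (by norm_num) (by norm_num) (by norm_num)).trans hW)
    (by simp [hs₄, hcard]) (by simp [hs₄]) ?_ (htab.congr fun x _ hx => hmem₄ x (by omega))
    (by omega) hDW fun g => ?_) ?_
  · rw [← hcard]
    exact Nat.le_of_dvd Nat.card_pos P₁.card_subgroup_dvd_card
  · have := hN0 g
    simpa using (hmem₄ (D + N + e g) (by omega)).trans (hzero _ (by omega) (by omega))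
  rintro s₅ ⟨hs₅, hmem₅, P₂, hP₂, hset₂⟩
  refine WP.add ⟨fun r hr h5 h7 h8 => ?_, ?_, fun x hx => ?_, P₁, P₂, hP₁.isHall_lt,
    hP₂.isHall_compl hP₁.isHall_lt, hset₁.congr fun x hx hx' => ?_, hset₂⟩
  · rw [State.reg_setReg, if_neg h5, hs₅ r hr, hs₄' r hr h5 h7 h8]
  · have h3 : s₅.reg 3 = N := by
      rw [hs₅ 3 (by norm_num), hs₄' 3 (by norm_num) (by norm_num) (by norm_num) (by norm_num), hN]
    have h5 : s₅.reg 5 = D + N := by rw [hs₅ 5 (by norm_num)]; simp [hs₄]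
    simp [h3, h5]
  · rw [State.mem_setReg, hmem₅ x (by omega), hmem₄ x (by omega)]
  · rw [State.mem_setReg, hmem₅ x (by omega), ← hmem₃]
    rfl

/-- The reduction. The memory is extended by the characteristic vectors of complementary Hall
subgroups of both groups so that it spells out, from address `0` on, the single query that is made.
Register `6` contains its length, which is also the address of the scratch space of
`greedyCmd`. -/
def reductionCmd : Cmd :=
  .const 2 1 ;; .const 9 0 ;; .load 3 9 ;; .load 10 2 ;; .add 5 0 9 ;; .const 4 2 ;;
    .add 6 0 3 ;; .add 6 6 3 ;; .add 6 6 10 ;; .add 6 6 10 ;; .const 11 2 ;;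
    forLoop 12 3 (.add 11 11 3) ;; hallPairCmd ;; .add 3 10 9 ;; .add 4 11 9 ;; hallPairCmd ;;
    .query 0 9 6

/-- Running time of `reductionCmd` for groups of orders `m` and `n`. -/
def reductionTime {R : Type*} [CommSemiring R] (m n : R) : R :=
  hallPairTime m + hallPairTime n + m * m + n * n + m * 6 + n * 2 + 19

end OracleRAM

section Encodings

open OracleRAM

variable {G H : Type} [Group G] [Group H] {m n : ℕ}

theorem List.getElem?_flatMap_of_length_eq {α β : Type*} {f : α → List β} {n : ℕ}
    (hf : ∀ a, (f a).length = n) (l : List α) {i j : ℕ} (hi : i < l.length) (hj : j < n) :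
    (l.flatMap f)[i * n + j]? = (f l[i])[j]? := by
  induction l generalizing i with
  | nil => simp at hi
  | cons a l ih =>
    rw [List.flatMap_cons]
    cases i with
    | zero => rw [List.getElem?_append_left (by rw [hf]; omega)]; simp
    | succ i =>
      rw [List.getElem?_append_right (by rw [hf, Nat.succ_mul]; omega), hf,
        show (i + 1) * n + j - n = i * n + j by rw [Nat.succ_mul]; omega,
        ih (by simpa using hi)]
      simp

theorem length_cayleyTable (e : G ≃ Fin n) : (cayleyTable e).length = n * n := by
  simp [cayleyTable, List.length_flatMap]

theorem getElem?_cayleyTable (e : G ≃ Fin n) (g h : G) :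
    (cayleyTable e)[(e g : ℕ) * n + e h]? = some (e (g * h) : ℕ) := by
  rw [cayleyTable, List.getElem?_flatMap_of_length_eq (n := n) (by simp) _ (by simp) (e h).2]
  simp

theorem length_groupPairCode (eG : G ≃ Fin m) (eH : H ≃ Fin n) :
    (groupPairCode eG eH).length = 2 + m * m + n * n := by
  simp [groupPairCode, length_cayleyTable]
  omega

namespace OracleRAM

theorem State.word_add (s : State) (a l l' : ℕ) :
    s.word a (l + l') = s.word a l ++ s.word (a + l) l' := by
  simp [State.word, List.range_add, add_assoc]

theorem State.word_eq_of_forall {s : State} {w : List ℕ}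
    (h : ∀ x < w.length, s.mem x = w.getD x 0) : s.word 0 w.length = w := by
  refine List.ext_getElem (by simp [State.word]) fun i h₁ h₂ => ?_
  simp [State.word, h i h₂, h₂]

theorem HasSet.word_eq {s : State} {e : G ≃ Fin n} {A : ℕ} {P : Subgroup G}
    (h : HasSet s.mem A e (P : Set G)) : s.word A n = subgroupCode e P := by
  refine List.ext_getElem (by simp [State.word, subgroupCode]) fun i h₁ h₂ => ?_
  have hi : i < n := by simpa [State.word] using h₁
  have hf : (List.finRange n)[i]'(by simpa using hi) = ⟨i, hi⟩ := by simp
  have := h (e.symm ⟨i, hi⟩)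
  rw [Equiv.apply_symm_apply] at this
  simp only [State.word, subgroupCode, List.getElem_map, List.getElem_range]
  rw [hf]
  exact this

theorem hasTable_groupPairCode_left (eG : G ≃ Fin m) (eH : H ≃ Fin n) :
    HasTable (fun x => (groupPairCode eG eH).getD x 0) 2 eG := fun a b => by
  have h1 := (eG a).2
  have h2 := (eG b).2
  have h : (eG a : ℕ) * m + eG b < (cayleyTable eG).length := by
    rw [length_cayleyTable]; nlinarith
  simp only [groupPairCode, List.getD_eq_getElem?_getD]
  rw [add_comm 2]
  simp only [List.getElem?_cons_succ]
  rw [List.getElem?_append_left h, getElem?_cayleyTable, Option.getD_some]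

theorem hasTable_groupPairCode_right (eG : G ≃ Fin m) (eH : H ≃ Fin n) :
    HasTable (fun x => (groupPairCode eG eH).getD x 0) (2 + m * m) eH := fun a b => by
  simp only [groupPairCode, List.getD_eq_getElem?_getD]
  rw [add_assoc, add_comm 2]
  simp only [List.getElem?_cons_succ]
  rw [List.getElem?_append_right (by rw [length_cayleyTable]; omega), length_cayleyTable,
    Nat.add_sub_cancel_left, getElem?_cayleyTable, Option.getD_some]

/-- Correctness of the reduction, from any initial contents of the registers other than `0` and `1`. -/
theorem WP.reductionCmd [Group.IsSolvable G] [Group.IsSolvable H] {eG : G ≃ Fin m} {eH : H ≃ Fin n}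
    {O : Oracle} {s : State} {α : ℝ} (hO : TestsAlphaDecompositionIso α eG eH O)
    (h0 : s.reg 0 = (groupPairCode eG eH).length) (hk : s.reg 1 = ⌊α⌋₊)
    (hmem : ∀ x, s.mem x = (groupPairCode eG eH).getD x 0) :
    WP O reductionCmd (reductionTime m n) (fun s' => s'.Accepting ↔ Nonempty (G ≃* H)) s := by
  have hfinG : Finite G := Finite.of_equiv _ eG.symm
  have hfinH : Finite H := Finite.of_equiv _ eH.symm
  have hlen := length_groupPairCode eG eH
  have hs0 : s.mem 0 = m := by rw [hmem]; rfl
  have hs1 : s.mem 1 = n := by rw [hmem]; rfl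
  have htabG : HasTable s.mem 2 eG :=
    (hasTable_groupPairCode_left eG eH).congr fun x _ _ => hmem x
  have htabH : HasTable s.mem (2 + m * m) eH :=
    (hasTable_groupPairCode_right eG eH).congr fun x _ _ => hmem x
  have hzero : ∀ x, 2 + m * m + n * n ≤ x → s.mem x = 0 := fun x hx => by
    rw [hmem, List.getD_eq_default]; omega
  set L := 2 + m * m + n * n with hL
  rw [hlen] at h0
  set W := L + m + m + n + n with hW
  refine WP.mono (T := ((m * 4 + 3) + (hallPairTime m + (hallPairTime n + (W + 1) + 1 + 1))) +
    1 + 1 + 1 + 1 + 1 + 1 + 1 + 1 + 1 + 1 + 1) ?_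
    (le_of_eq (by unfold reductionTime; rw [hW, hL]; ring)) fun _ h => h
  refine WP.const_seq (WP.const_seq (WP.load_seq (WP.load_seq (WP.add_seq (WP.const_seq
    (WP.add_seq (WP.add_seq (WP.add_seq (WP.add_seq (WP.const_seq ?_))))))))))
  simp only [State.reg_setReg, State.mem_setReg, Nat.reduceEqDiff, if_true, if_false, h0, hs0, hs1,
    add_zero, OfNat.zero_ne_ofNat]
  refine WP.seq_of (Q' := fun s' => s'.reg 1 = ⌊α⌋₊ ∧ s'.reg 2 = 1 ∧ s'.reg 3 = m ∧ s'.reg 4 = 2 ∧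
    s'.reg 5 = L ∧ s'.reg 6 = W ∧ s'.reg 9 = 0 ∧ s'.reg 10 = n ∧ s'.reg 11 = 2 + m * m ∧
    s'.mem = s.mem) ?_ ?_
  · refine WP.forLoop (T := 1) (fun j s' => s'.reg 1 = ⌊α⌋₊ ∧ s'.reg 2 = 1 ∧ s'.reg 3 = m ∧
      s'.reg 4 = 2 ∧ s'.reg 5 = L ∧ s'.reg 6 = W ∧ s'.reg 9 = 0 ∧ s'.reg 10 = n ∧
      s'.reg 11 = 2 + j * m ∧ s'.mem = s.mem) (N := m) (by norm_num) (by norm_num) (by simp)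
      (by simp) (by simp [hk, hW]) ?_ ?_ fun _ h => h
    · intro j s' r v hr h
      simpa [show 1 ≠ r by omega, show 2 ≠ r by omega, show 3 ≠ r by omega, show 4 ≠ r by omega,
        show 5 ≠ r by omega, show 6 ≠ r by omega, show 9 ≠ r by omega, show 10 ≠ r by omega,
        show 11 ≠ r by omega] using h
    · rintro j s' _ ⟨i1, i2, i3, i4, i5, i6, i9, i10, i11, imem⟩ hj - -
      refine WP.add ?_
      simp [i1, i2, i3, i4, i5, i6, i9, i10, i11, imem, hj, Nat.succ_mul, add_assoc]
  rintro s₁ ⟨i1, i2, i3, i4, i5, i6, i9, i10, i11, imem⟩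
  refine WP.seq_of (WP.hallPairCmd (e := eG) i1 i2 i3 i4 i5 i6 i9 (imem ▸ htabG) (by omega)
    (by omega) fun x hx _ => by rw [imem]; exact hzero x hx) ?_
  rintro s₂ ⟨hs₂, j5, hmem₂, P₁, P₂, hP₁, hP₂, hset₁, hset₂⟩
  have j : ∀ r < 20, r ≠ 5 ∧ r ≠ 7 ∧ r ≠ 8 → s₂.reg r = s₁.reg r :=
    fun r hr h => hs₂ r hr h.1 h.2.1 h.2.2
  have j1 := (j 1 (by norm_num) (by norm_num)).trans i1
  have j2 := (j 2 (by norm_num) (by norm_num)).trans i2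
  have j6 := (j 6 (by norm_num) (by norm_num)).trans i6
  have j9 := (j 9 (by norm_num) (by norm_num)).trans i9
  have j10 := (j 10 (by norm_num) (by norm_num)).trans i10
  have j11 := (j 11 (by norm_num) (by norm_num)).trans i11
  rw [imem] at hmem₂
  refine WP.add_seq (WP.add_seq ?_)
  simp only [State.reg_setReg, Nat.reduceEqDiff, if_false, j9, j10, j11, add_zero]
  refine WP.seq_of (WP.hallPairCmd (e := eH) (k := ⌊α⌋₊) (T := 2 + m * m) (D := L + m + m) (W := W)
    (by simp [j1]) (by simp [j2]) (by simp) (by simp) (by simp [j5]) (by simp [j6]) (by simp [j9])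
    (htabH.congr fun x _ hx => hmem₂ x (by omega)) (by omega) (by omega) fun x hx hx' => ?_) ?_
  · exact (hmem₂ x (by omega)).trans (hzero x (by omega))
  rintro s₃ ⟨hs₃, -, hmem₃, Q₁, Q₂, hQ₁, hQ₂, hset₃, hset₄⟩
  have k6 : s₃.reg 6 = W := by
    rw [hs₃ 6 (by norm_num) (by norm_num) (by norm_num) (by norm_num)]; simp [j6]
  have k9 : s₃.reg 9 = 0 := by
    rw [hs₃ 9 (by norm_num) (by norm_num) (by norm_num) (by norm_num)]; simp [j9]
  simp only [State.mem_setReg] at hmem₃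
  have hword : s₃.word 0 W = decompositionPairCode eG eH P₁ P₂ Q₁ Q₂ := by
    have hcode : s₃.word 0 L = groupPairCode eG eH := by
      rw [← hlen]
      refine State.word_eq_of_forall fun x hx => ?_
      rw [hmem₃ x (by omega), hmem₂ x (by omega), hmem]
    have hset₁' : HasSet s₃.mem L eG (P₁ : Set G) :=
      hset₁.congr fun x _ hx => hmem₃ x (by omega)
    have hset₂' : HasSet s₃.mem (L + m) eG (P₂ : Set G) :=
      hset₂.congr fun x _ hx => hmem₃ x (by omega)
    rw [hW, State.word_add, State.word_add, State.word_add, State.word_add, hcode]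
    simp only [zero_add]
    rw [hset₁'.word_eq, hset₂'.word_eq, hset₃.word_eq, hset₄.word_eq]
    rfl
  have hquery := hO P₁ P₂ Q₁ Q₂ (hP₁.isAlphaDecomposition hP₂) (hQ₁.isAlphaDecomposition hQ₂)
  rw [pairIso_iff_nonempty_mulEquiv hP₁ hP₂ hQ₁ hQ₂] at hquery
  have := WP.query (O := O) (s := s₃) (r := 0) (x := 9) (l := 6)
    (Q := fun s' => s'.Accepting ↔ Nonempty (G ≃* H)) ?_
  · rwa [k6] at this
  · rw [k6, k9, hword, ← hquery]
    simp [State.Accepting]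

end OracleRAM

/-- A polynomial bound for `OracleRAM.reductionTime m n` in terms of `m + n`. -/
noncomputable def reductionPolynomial : Polynomial ℕ := reductionTime .X .X

theorem reductionTime_le_eval (m n : ℕ) :
    reductionTime m n ≤ reductionPolynomial.eval (m + n) := by
  have h : reductionPolynomial.eval (m + n) = reductionTime (m + n) (m + n) := by
    simp [reductionPolynomial, reductionTime, hallPairTime, greedyTime]
  have hm : m ≤ m + n := Nat.le_add_right m n
  have hn : n ≤ m + n := Nat.le_add_left n m
  rw [h]
  generalize m + n = x at hm hn
  unfold reductionTime hallPairTime greedyTime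
  gcongr

end Encodings

theorem mainTheorem8 :
    -- for every `α`, a polynomial-time Turing reduction
    (∀ α : ℝ, ∃ (M : OracleRAM.Cmd) (p : Polynomial ℕ),
      ∀ (G H : Type) [Group G] [Group H] [Group.IsSolvable G] [Group.IsSolvable H] (m n : ℕ)
        (eG : G ≃ Fin m) (eH : H ≃ Fin n) (O : OracleRAM.Oracle),
        TestsAlphaDecompositionIso α eG eH O → DecidesGroupIso M p O 0 eG eH) ∧
    -- and one reduction for all `α` at once, which may therefore depend on the groups,
    -- if the integer part of `α` is supplied with the input
    (∃ (M : OracleRAM.Cmd) (p : Polynomial ℕ),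
      ∀ (α : ℝ) (G H : Type) [Group G] [Group H] [Group.IsSolvable G] [Group.IsSolvable H] (m n : ℕ)
        (eG : G ≃ Fin m) (eH : H ≃ Fin n) (O : OracleRAM.Oracle),
        TestsAlphaDecompositionIso α eG eH O → DecidesGroupIso M p O ⌊α⌋₊ eG eH) := by
  refine ⟨fun α => ⟨.seq (.const 1 ⌊α⌋₊) OracleRAM.reductionCmd, reductionPolynomial + 1, ?_⟩,
    OracleRAM.reductionCmd, reductionPolynomial, ?_⟩
  · intro G H _ _ _ _ m n eG eH O hO
    obtain ⟨t, s, ht, he, hs⟩ := OracleRAM.WP.const_seq (O := O) (r := 1)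
      (OracleRAM.WP.reductionCmd hO (s := (OracleRAM.State.initial (groupPairCode eG eH) 0).setReg 1
        ⌊α⌋₊) (by simp [OracleRAM.State.initial]) (by simp) fun x => rfl)
    refine ⟨t, s, he, ht.trans ?_, hs⟩
    have := reductionTime_le_eval m n
    simpa using this
  · intro α G H _ _ _ _ m n eG eH O hO
    obtain ⟨t, s, ht, he, hs⟩ := OracleRAM.WP.reductionCmd hO
      (s := OracleRAM.State.initial (groupPairCode eG eH) ⌊α⌋₊) (by simp [OracleRAM.State.initial])
      (by simp [OracleRAM.State.initial]) fun x => rfl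
    exact ⟨t, s, he, ht.trans (reductionTime_le_eval m n), hs⟩
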